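/- Let $\mathbb T=\mathbb R/2\pi\mathbb Z$ and let $L^2_{per}$ be the complex Hilbert space of $2\pi$-periodic functions $f:\mathbb R\to\mathbb C$ that are square integrable over a period, with $\langle f,g\rangle=\int_{-\pi}^{\pi}f\,\overline g\,dx$ and $\widehat f(k)=\frac1{2\pi}\int_{-\pi}^{\pi}f(x)e^{-ikx}\,dx$. For $s\in\{1,2\}$ put $H^s_{per}=\{f\in L^2_{per}:\sum_{k\in\mathbb Z}(1+k^2)^s|\widehat f(k)|^2<\infty\}$, and let $A=-\frac{d^2}{dx^2}$ with domain $D(A)=H^2_{per}$, i.e. $\widehat{A\psi}(k)=k^2\widehat\psi(k)$. Elements of $H^1_{per}$ are identified with their continuous representatives. For $\Omega\subset\mathbb R$ open, $H^2(\Omega)$ is the space of functions in $L^2(\Omega)$ whose weak derivatives up to order $2$ are in $L^2(\Omega)$. Let $A^0$ be the restriction of $A$ to $D(A^0)=\{\psi\in H^2_{per}:\psi(0)=0\}$. Then $A^0$ is a densely defined symmetric operator on $L^2_{per}$ with deficiency indices $(1,1)$, that is, $\dim\operatorname{Ker}((A^0)^*-i)=\dim\operatorname{Ker}((A^0)^*+i)=1$.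 For $\gamma\in(-\infty,+\infty]$ let $-\Delta_\gamma$ be the operator $\zeta\mapsto-\zeta''$ (the weak derivative being taken on $\mathbb R\setminus 2\pi\mathbb Z$) with domain $$D(-\Delta_\gamma)=\{\zeta\in H^1_{per}:\ \zeta\in H^2((-\pi,\pi)\setminus\{0\}),\ \zeta\in H^2((2n\pi,2(n+1)\pi))\ \text{for all } n\in\mathbb Z,\ \zeta'(0+)-\zeta'(0-)=\gamma\,\zeta(0)\},$$ where for $\gamma=+\infty$ the last condition is replaced by $\zeta(0)=0$. Then a linear operator $B$ on $L^2_{per}$ is a self-adjoint extension of $A^0$ if and only if $B=-\Delta_\gamma$ for some $\gamma\in(-\infty,+\infty]$. Moreover $-\Delta_0=A$; in particular $D(-\Delta_0)=H^2_{per}$. -/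

import Mathlib

open MeasureTheory Filter Topology Set
open scoped Real ContDiff ENNReal

noncomputable section

namespace PeriodicDelta

instance factTwoPiPos : Fact (0 < 2 * π) := ⟨Real.two_pi_pos⟩

/-- The torus `𝕋 = ℝ / 2πℤ`. -/
abbrev Torus : Type := AddCircle (2 * π)

/-- The complex Hilbert space of square-integrable `2π`-periodic functions, for the measure of
total mass `2π`, so that the norm squared is the integral of `|f|²` over a period. -/
abbrev L2per : Type := Lp ℂ 2 (volume : Measure Torus)

/-- The `2π`-periodic function on `ℝ` given by a function on the torus. -/
def lift (f : Torus → ℂ) : ℝ → ℂ := fun x => f (x : Torus)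

/-! ### Sobolev spaces on open subsets of the line -/

/-- `g` is the weak derivative of order `n` of `f` on the open set `Ω`, tested against real
smooth functions with compact support in `Ω`. -/
def HasWeakDeriv (Ω : Set ℝ) (n : ℕ) (f g : ℝ → ℂ) : Prop :=
  ∀ φ : ℝ → ℝ, ContDiff ℝ ∞ φ → HasCompactSupport φ → tsupport φ ⊆ Ω →
    ∫ x in Ω, iteratedDeriv n φ x • f x = (-1) ^ n * ∫ x in Ω, φ x • g x

/-- `f ∈ Hⁿ(Ω)`: the function and its weak derivatives up to order `n` are in `L²(Ω)`. -/
def MemSobolev (Ω : Set ℝ) (n : ℕ) (f : ℝ → ℂ) : Prop :=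
  MemLp f 2 (volume.restrict Ω) ∧
    ∀ j ≤ n, ∃ g : ℝ → ℂ, MemLp g 2 (volume.restrict Ω) ∧ HasWeakDeriv Ω j f g

theorem integrable_test {Ω : Set ℝ} {f : ℝ → ℂ} (hf : MemLp f 2 (volume.restrict Ω)) (n : ℕ)
    {φ : ℝ → ℝ} (hφ : ContDiff ℝ ∞ φ) (hc : HasCompactSupport φ) :
    Integrable (fun x => iteratedDeriv n φ x • f x) (volume.restrict Ω) := by
  have h1 : Continuous (iteratedDeriv n φ) :=
    hφ.continuous_iteratedDeriv n (by exact_mod_cast le_top)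
  have h2 : HasCompactSupport (iteratedDeriv n φ) := by
    rw [iteratedDeriv_eq_iterate]
    clear h1
    induction n with
    | zero => exact hc
    | succ n ih =>
      rw [Function.iterate_succ_apply']
      exact ih.deriv
  have h3 : MemLp (iteratedDeriv n φ) 2 (volume.restrict Ω) :=
    (h1.memLp_of_hasCompactSupport h2).restrict Ω
  exact memLp_one_iff_integrable.1 (hf.smul h3)

theorem HasWeakDeriv.add {Ω : Set ℝ} {n : ℕ} {f₁ f₂ g₁ g₂ : ℝ → ℂ}
    (hf₁ : MemLp f₁ 2 (volume.restrict Ω)) (hf₂ : MemLp f₂ 2 (volume.restrict Ω))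
    (hg₁ : MemLp g₁ 2 (volume.restrict Ω)) (hg₂ : MemLp g₂ 2 (volume.restrict Ω))
    (h₁ : HasWeakDeriv Ω n f₁ g₁) (h₂ : HasWeakDeriv Ω n f₂ g₂) :
    HasWeakDeriv Ω n (f₁ + f₂) (g₁ + g₂) := by
  intro φ hφ hc hs
  have a := integral_add (integrable_test hf₁ n hφ hc) (integrable_test hf₂ n hφ hc)
  have b := integral_add (integrable_test hg₁ 0 hφ hc) (integrable_test hg₂ 0 hφ hc)
  simp only [iteratedDeriv_zero] at b
  simp only [Pi.add_apply, smul_add]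
  rw [a, b, h₁ φ hφ hc hs, h₂ φ hφ hc hs, mul_add]

theorem HasWeakDeriv.smul {Ω : Set ℝ} {n : ℕ} {f g : ℝ → ℂ} (c : ℂ)
    (h : HasWeakDeriv Ω n f g) : HasWeakDeriv Ω n (c • f) (c • g) := by
  intro φ hφ hc hs
  simp only [Pi.smul_apply, smul_comm _ c]
  rw [integral_smul, integral_smul, h φ hφ hc hs, smul_eq_mul, smul_eq_mul, mul_left_comm]

theorem HasWeakDeriv.congr {Ω : Set ℝ} {n : ℕ} {f f' g g' : ℝ → ℂ}
    (hf : f =ᵐ[volume.restrict Ω] f') (hg : g =ᵐ[volume.restrict Ω] g')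
    (h : HasWeakDeriv Ω n f g) : HasWeakDeriv Ω n f' g' := by
  intro φ hφ hc hs
  have a : ∫ x in Ω, iteratedDeriv n φ x • f' x = ∫ x in Ω, iteratedDeriv n φ x • f x :=
    integral_congr_ae (by filter_upwards [hf] with x hx; rw [hx])
  have b : ∫ x in Ω, φ x • g' x = ∫ x in Ω, φ x • g x :=
    integral_congr_ae (by filter_upwards [hg] with x hx; rw [hx])
  rw [a, b, h φ hφ hc hs]

theorem HasWeakDeriv.unique {Ω : Set ℝ} (hΩ : IsOpen Ω) {n : ℕ} {f g g' : ℝ → ℂ}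
    (hg : MemLp g 2 (volume.restrict Ω)) (hg' : MemLp g' 2 (volume.restrict Ω))
    (h : HasWeakDeriv Ω n f g) (h' : HasWeakDeriv Ω n f g') :
    g =ᵐ[volume.restrict Ω] g' := by
  have hloc : LocallyIntegrableOn (g - g') Ω volume := by
    rw [locallyIntegrableOn_iff hΩ.isLocallyClosed]
    intro K hK hKc
    have : MemLp (g - g') 2 (volume.restrict K) :=
      (hg.sub hg').mono_measure (Measure.restrict_mono hK le_rfl)
    have hfin : IsFiniteMeasure (volume.restrict K) := ⟨by simpa using hKc.measure_lt_top⟩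
    exact MemLp.integrable (by norm_num) this
  have key := hΩ.ae_eq_zero_of_integral_contDiff_smul_eq_zero hloc (by
    intro φ hφ hc hs
    have e := (h φ hφ hc hs).symm.trans (h' φ hφ hc hs)
    have e' := mul_left_cancel₀ (pow_ne_zero n (by norm_num)) e
    have a := integral_sub (integrable_test hg 0 hφ hc) (integrable_test hg' 0 hφ hc)
    simp only [iteratedDeriv_zero] at a
    have hz : ∀ x, x ∉ Ω → φ x • (g - g') x = 0 := by
      intro x hx
      rw [image_eq_zero_of_notMem_tsupport (fun hx' => hx (hs hx')), zero_smul]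
    rw [← setIntegral_eq_integral_of_forall_compl_eq_zero hz]
    simp only [Pi.sub_apply, smul_sub]
    rw [a, e', sub_self])
  rw [EventuallyEq, ae_restrict_iff' hΩ.measurableSet]
  filter_upwards [key] with x hx hxΩ
  exact sub_eq_zero.1 (hx hxΩ)

theorem MemSobolev.add {Ω : Set ℝ} {n : ℕ} {f₁ f₂ : ℝ → ℂ} (h₁ : MemSobolev Ω n f₁)
    (h₂ : MemSobolev Ω n f₂) : MemSobolev Ω n (f₁ + f₂) := by
  refine ⟨h₁.1.add h₂.1, fun j hj => ?_⟩
  obtain ⟨g₁, m₁, w₁⟩ := h₁.2 j hj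
  obtain ⟨g₂, m₂, w₂⟩ := h₂.2 j hj
  exact ⟨g₁ + g₂, m₁.add m₂, w₁.add h₁.1 h₂.1 m₁ m₂ w₂⟩

theorem MemSobolev.smul {Ω : Set ℝ} {n : ℕ} {f : ℝ → ℂ} (c : ℂ) (h : MemSobolev Ω n f) :
    MemSobolev Ω n (c • f) := by
  refine ⟨h.1.const_smul c, fun j hj => ?_⟩
  obtain ⟨g, m, w⟩ := h.2 j hj
  exact ⟨c • g, m.const_smul c, w.smul c⟩

theorem MemSobolev.congr {Ω : Set ℝ} {n : ℕ} {f f' : ℝ → ℂ}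
    (hf : f =ᵐ[volume.restrict Ω] f') (h : MemSobolev Ω n f) : MemSobolev Ω n f' := by
  refine ⟨h.1.ae_eq hf, fun j hj => ?_⟩
  obtain ⟨g, m, w⟩ := h.2 j hj
  exact ⟨g, m, w.congr hf (ae_eq_refl g)⟩

theorem MemSobolev.zero (Ω : Set ℝ) (n : ℕ) : MemSobolev Ω n 0 :=
  ⟨MemLp.zero, fun _ _ => ⟨0, MemLp.zero, fun φ _ _ _ => by simp⟩⟩

theorem lift_ae {f g : Torus → ℂ} (h : f =ᵐ[volume] g) : lift f =ᵐ[volume] lift g := by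
  have key : ∀ n : ℤ, lift f =ᵐ[volume.restrict
      (Ioc (0 + n • (2 * π)) (0 + (n + 1) • (2 * π)))] lift g := by
    intro n
    have e : (0 + (n + 1) • (2 * π)) = (0 + n • (2 * π)) + 2 * π := by
      rw [add_smul, one_smul, add_assoc]
    rw [e]
    exact (AddCircle.measurePreserving_mk (2 * π) (0 + n • (2 * π))).quasiMeasurePreserving.ae_eq h
  have := (ae_restrict_iUnion_iff
    (fun n : ℤ => Ioc (0 + n • (2 * π)) (0 + (n + 1) • (2 * π)))
    (fun x => lift f x = lift g x)).2 key
  rwa [iUnion_Ioc_add_zsmul Real.two_pi_pos, Measure.restrict_univ] at this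

theorem lift_add (f g : L2per) (Ω : Set ℝ) :
    lift ⇑f + lift ⇑g =ᵐ[volume.restrict Ω] lift ⇑(f + g) :=
  (lift_ae (Lp.coeFn_add f g).symm).filter_mono (ae_mono Measure.restrict_le_self)

theorem lift_smul (c : ℂ) (f : L2per) (Ω : Set ℝ) :
    c • lift ⇑f =ᵐ[volume.restrict Ω] lift ⇑(c • f) :=
  (lift_ae (Lp.coeFn_smul c f).symm).filter_mono (ae_mono Measure.restrict_le_self)

theorem lift_zero (Ω : Set ℝ) : (0 : ℝ → ℂ) =ᵐ[volume.restrict Ω] lift ⇑(0 : L2per) :=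
  (lift_ae (Lp.coeFn_zero ℂ 2 volume).symm).filter_mono (ae_mono Measure.restrict_le_self)

/-! ### Periodic Sobolev spaces and the periodic Laplacian -/

theorem integrable_haar (f : L2per) : Integrable (⇑f) (AddCircle.haarAddCircle (T := 2 * π)) :=
  (MeasureTheory.MemLp.haarAddCircle (Lp.memLp f)).integrable (by norm_num)

theorem ae_haar {f g : Torus → ℂ} (h : f =ᵐ[volume] g) :
    f =ᵐ[AddCircle.haarAddCircle (T := 2 * π)] g := by
  rw [AddCircle.volume_eq_smul_haarAddCircle] at h
  have hc : ENNReal.ofReal (2 * π) ≠ 0 := by simp [Real.pi_pos]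
  exact (Measure.ae_ennreal_smul_measure_iff hc).1 h

theorem fourierCoeff_add (f g : L2per) (k : ℤ) :
    fourierCoeff ⇑(f + g) k = fourierCoeff ⇑f k + fourierCoeff ⇑g k := by
  rw [fourierCoeff_congr_ae (ae_haar (Lp.coeFn_add f g)),
    fourierCoeff.add (integrable_haar f) (integrable_haar g), Pi.add_apply]

theorem fourierCoeff_smul (c : ℂ) (f : L2per) (k : ℤ) :
    fourierCoeff ⇑(c • f) k = c * fourierCoeff ⇑f k := by
  rw [fourierCoeff_congr_ae (ae_haar (Lp.coeFn_smul c f)), fourierCoeff.const_smul, smul_eq_mul]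

theorem fourierCoeff_zero (k : ℤ) : fourierCoeff ⇑(0 : L2per) k = 0 := by
  simpa using fourierCoeff_smul 0 0 k

theorem eq_of_fourierCoeff {f g : L2per} (h : ∀ k, fourierCoeff ⇑f k = fourierCoeff ⇑g k) :
    f = g := by
  have mf := MeasureTheory.MemLp.haarAddCircle (Lp.memLp f)
  have mg := MeasureTheory.MemLp.haarAddCircle (Lp.memLp g)
  have e : mf.toLp = mg.toLp := by
    apply (fourierBasis (T := 2 * π)).repr.injective
    ext k
    rw [fourierBasis_repr, fourierBasis_repr, fourierCoeff_congr_ae mf.coeFn_toLp,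
      fourierCoeff_congr_ae mg.coeFn_toLp, h k]
  have e' := (MemLp.toLp_eq_toLp_iff mf mg).1 e
  apply Lp.ext
  have key : ∀ F G : Torus → ℂ, F =ᵐ[AddCircle.haarAddCircle (T := 2 * π)] G →
      F =ᵐ[volume] G := by
    intro F G h
    rw [AddCircle.volume_eq_smul_haarAddCircle]
    exact Measure.ae_smul_measure h _
  exact key _ _ e'

theorem exists_fourierCoeff {a : ℤ → ℂ} (h : Summable fun k => ‖a k‖ ^ 2) :
    ∃ f : L2per, ∀ k, fourierCoeff ⇑f k = a k := by
  have ha : Memℓp a 2 := by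
    rw [memℓp_gen_iff (by norm_num)]
    simpa using h
  let F := (fourierBasis (T := 2 * π)).repr.symm ⟨a, ha⟩
  have mF : MemLp (⇑F) 2 (volume : Measure Torus) := MeasureTheory.MemLp.of_haarAddCircle (Lp.memLp F)
  refine ⟨mF.toLp, fun k => ?_⟩
  rw [fourierCoeff_congr_ae (ae_haar mF.coeFn_toLp), ← fourierBasis_repr]
  simp [F]

/-- The periodic Sobolev space of integer order `s ≥ 0`: the `f` in `L²` of the torus with
`∑ (1 + k²)ˢ |f̂(k)|² < ∞`, where `f̂(k) = (1/2π) ∫ f(x) exp(-ikx) dx` over a period. -/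
def Hper (s : ℕ) : Submodule ℂ L2per where
  carrier := {f | Summable fun k : ℤ => (1 + (k : ℝ) ^ 2) ^ s * ‖fourierCoeff ⇑f k‖ ^ 2}
  zero_mem' := by
    change Summable fun k : ℤ => (1 + (k : ℝ) ^ 2) ^ s * ‖fourierCoeff ⇑(0 : L2per) k‖ ^ 2
    simp_rw [fourierCoeff_zero]
    simp
  add_mem' := by
    intro f g hf hg
    simp only [mem_ofPred_eq] at *
    refine Summable.of_nonneg_of_le (fun k => by positivity) (fun k => ?_)
      ((hf.mul_left 2).add (hg.mul_left 2))
    rw [fourierCoeff_add]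
    have h1 : ‖fourierCoeff ⇑f k + fourierCoeff ⇑g k‖ ^ 2 ≤
        2 * ‖fourierCoeff ⇑f k‖ ^ 2 + 2 * ‖fourierCoeff ⇑g k‖ ^ 2 := by
      have := norm_add_le (fourierCoeff ⇑f k) (fourierCoeff ⇑g k)
      nlinarith [sq_nonneg (‖fourierCoeff ⇑f k‖ - ‖fourierCoeff ⇑g k‖),
        norm_nonneg (fourierCoeff ⇑f k + fourierCoeff ⇑g k)]
    have h2 : 0 ≤ (1 + (k : ℝ) ^ 2) ^ s := by positivity
    nlinarith [mul_le_mul_of_nonneg_left h1 h2]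
  smul_mem' := by
    intro c f hf
    simp only [mem_ofPred_eq] at *
    refine (hf.mul_left (‖c‖ ^ 2)).congr fun k => ?_
    rw [fourierCoeff_smul, norm_mul]
    ring

theorem exists_negSecondDerivPer (f : Hper 2) :
    ∃ g : L2per, ∀ k : ℤ, fourierCoeff ⇑g k = (k : ℂ) ^ 2 * fourierCoeff ⇑(f : L2per) k := by
  apply exists_fourierCoeff
  refine Summable.of_nonneg_of_le (fun k => by positivity) (fun k => ?_) f.2
  rw [norm_mul, mul_pow]
  apply mul_le_mul_of_nonneg_right _ (by positivity)
  rw [norm_pow, Complex.norm_intCast, sq_abs]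
  gcongr
  linarith

/-- The operator `A = -d²/dx²` on `L²` of the torus with domain `H²` of the torus; the derivative
of a periodic distribution multiplies the `k`-th Fourier coefficient by `ik`, so `A` multiplies
it by `k²`. -/
def periodicLaplacian : L2per →ₗ.[ℂ] L2per where
  domain := Hper 2
  toFun :=
    { toFun := fun f => (exists_negSecondDerivPer f).choose
      map_add' := by
        intro f g
        apply eq_of_fourierCoeff
        intro k
        rw [fourierCoeff_add, (exists_negSecondDerivPer (f + g)).choose_spec,
          (exists_negSecondDerivPer f).choose_spec, (exists_negSecondDerivPer g).choose_spec,
          Submodule.coe_add, fourierCoeff_add, mul_add]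
      map_smul' := by
        intro c f
        apply eq_of_fourierCoeff
        intro k
        rw [RingHom.id_apply, fourierCoeff_smul, (exists_negSecondDerivPer (c • f)).choose_spec,
          (exists_negSecondDerivPer f).choose_spec, Submodule.coe_smul, fourierCoeff_smul,
          mul_left_comm] }

theorem fourierCoeff_periodicLaplacian (f : periodicLaplacian.domain) (k : ℤ) :
    fourierCoeff ⇑(periodicLaplacian f) k = (k : ℂ) ^ 2 * fourierCoeff ⇑(f : L2per) k :=
  (exists_negSecondDerivPer f).choose_spec k

/-- The (unique) continuous periodic function `u` represents `f`. -/
def IsContRep (u : C(Torus, ℂ)) (f : L2per) : Prop := ContinuousMap.toLp 2 volume ℂ u = f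

/-- The functions that have a continuous representative vanishing at `0`. -/
def vanishAtZero : Submodule ℂ L2per where
  carrier := {f | ∃ u : C(Torus, ℂ), IsContRep u f ∧ u 0 = 0}
  zero_mem' := ⟨0, map_zero _, rfl⟩
  add_mem' := by
    rintro f g ⟨u, hu, hu0⟩ ⟨v, hv, hv0⟩
    exact ⟨u + v, by rw [IsContRep, map_add, hu, hv], by simp [hu0, hv0]⟩
  smul_mem' := by
    rintro c f ⟨u, hu, hu0⟩
    exact ⟨c • u, by rw [IsContRep, map_smul, hu], by simp [hu0]⟩

/-- The operator `A⁰`: the restriction of `A` to `{ψ ∈ D(A) : ψ(0) = 0}`. -/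
def restrictedLaplacian : L2per →ₗ.[ℂ] L2per := periodicLaplacian.domRestrict vanishAtZero

/-! ### The `δ`-interaction of strength `γ` -/

/-- `u'(x)` exists for `x` near the limit point of `l` and tends to `a` along `l`. With `l = 𝓝[>] 0`
and `l = 𝓝[<] 0` this says `u'(0+) = a` and `u'(0-) = a`. -/
def DerivTendsto (u : ℝ → ℂ) (l : Filter ℝ) (a : ℂ) : Prop :=
  ∃ v : ℝ → ℂ, (∀ᶠ x in l, HasDerivAt u (v x) x) ∧ Tendsto v l (𝓝 a)

theorem DerivTendsto.add {u v : ℝ → ℂ} {l : Filter ℝ} {a b : ℂ} (hu : DerivTendsto u l a)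
    (hv : DerivTendsto v l b) : DerivTendsto (u + v) l (a + b) := by
  obtain ⟨p, hp, hp'⟩ := hu
  obtain ⟨q, hq, hq'⟩ := hv
  refine ⟨p + q, ?_, hp'.add hq'⟩
  filter_upwards [hp, hq] with x h1 h2
  exact h1.add h2

theorem DerivTendsto.smul {u : ℝ → ℂ} {l : Filter ℝ} {a : ℂ} (c : ℂ) (hu : DerivTendsto u l a) :
    DerivTendsto (c • u) l (c * a) := by
  obtain ⟨p, hp, hp'⟩ := hu
  refine ⟨c • p, ?_, hp'.const_smul c⟩
  filter_upwards [hp] with x h1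
  exact h1.const_smul c

theorem DerivTendsto.zero (l : Filter ℝ) : DerivTendsto 0 l 0 :=
  ⟨0, Eventually.of_forall fun x => hasDerivAt_const x 0, tendsto_const_nhds⟩

/-- The condition at the origin for strength `γ ∈ (-∞, +∞]`: `u'(0+) - u'(0-) = γ u(0)` for real
`γ`, and `u(0) = 0` for `γ = +∞`. -/
def InteractionCondition : WithTop ℝ → (Torus → ℂ) → Prop
  | ⊤, u => u 0 = 0
  | (γ : ℝ), u => ∃ a b : ℂ, DerivTendsto (lift u) (𝓝[>] 0) a ∧
      DerivTendsto (lift u) (𝓝[<] 0) b ∧ a - b = (γ : ℂ) * u 0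

theorem InteractionCondition.zero : ∀ γ : WithTop ℝ, InteractionCondition γ 0
  | ⊤ => rfl
  | (γ : ℝ) => ⟨0, 0, DerivTendsto.zero _, DerivTendsto.zero _, by simp⟩

theorem InteractionCondition.add : ∀ {γ : WithTop ℝ} {u v : Torus → ℂ},
    InteractionCondition γ u → InteractionCondition γ v → InteractionCondition γ (u + v)
  | ⊤, u, v, hu, hv => by
      have hu : u 0 = 0 := hu
      have hv : v 0 = 0 := hv
      change u 0 + v 0 = 0
      rw [hu, hv, add_zero]
  | (γ : ℝ), u, v, ⟨a, b, ha, hb, h⟩, ⟨a', b', ha', hb', h'⟩ =>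
      ⟨a + a', b + b', ha.add ha', hb.add hb', by
        rw [Pi.add_apply, mul_add, ← h, ← h']; ring⟩

theorem InteractionCondition.smul (c : ℂ) : ∀ {γ : WithTop ℝ} {u : Torus → ℂ},
    InteractionCondition γ u → InteractionCondition γ (c • u)
  | ⊤, u, hu => by
      have hu : u 0 = 0 := hu
      change c • u 0 = 0
      rw [hu, smul_zero]
  | (γ : ℝ), u, ⟨a, b, ha, hb, h⟩ =>
      ⟨c * a, c * b, ha.smul c, hb.smul c, by
        rw [Pi.smul_apply, smul_eq_mul, ← mul_sub, h]; ring⟩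

/-- `D(-Δ_γ)`: the `ζ` in `H¹` of the torus that are `H²` on `(-π, π) ∖ {0}` and on every
`(2nπ, 2(n+1)π)`, and whose continuous representative satisfies the condition of strength `γ` at
the origin. -/
def deltaDomain (γ : WithTop ℝ) : Submodule ℂ L2per where
  carrier := {ζ | ζ ∈ Hper 1 ∧ MemSobolev (Ioo (-π) π \ {0}) 2 (lift ζ) ∧
    (∀ n : ℤ, MemSobolev (Ioo (2 * n * π) (2 * (n + 1) * π)) 2 (lift ζ)) ∧
    ∃ u : C(Torus, ℂ), IsContRep u ζ ∧ InteractionCondition γ u}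
  zero_mem' := ⟨Submodule.zero_mem _, (MemSobolev.zero _ _).congr (lift_zero _),
    fun n => (MemSobolev.zero _ _).congr (lift_zero _), 0, map_zero _,
    InteractionCondition.zero γ⟩
  add_mem' := by
    rintro f g ⟨h1, h2, h3, u, hu, hu'⟩ ⟨k1, k2, k3, v, hv, hv'⟩
    exact ⟨Submodule.add_mem _ h1 k1, (h2.add k2).congr (lift_add f g _),
      fun n => ((h3 n).add (k3 n)).congr (lift_add f g _), u + v,
      by rw [IsContRep, map_add, hu, hv], hu'.add hv'⟩
  smul_mem' := by
    rintro c f ⟨h1, h2, h3, u, hu, hu'⟩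
    exact ⟨Submodule.smul_mem _ c h1, (h2.smul c).congr (lift_smul c f _),
      fun n => ((h3 n).smul c).congr (lift_smul c f _), c • u,
      by rw [IsContRep, map_smul, hu], hu'.smul c⟩

/-- `η = -ζ''` away from `2πℤ`: on the period `(0, 2π)`, the weak second derivative of `ζ` is
`-η`. -/
def IsNegSecondDeriv (ζ η : L2per) : Prop :=
  HasWeakDeriv (Ioo 0 (2 * π)) 2 (lift ζ) (-lift η)

theorem memLp_lift (f : L2per) : MemLp (lift f) 2 (volume.restrict (Ioo 0 (2 * π))) := by
  have h := (Lp.memLp f).comp_measurePreserving (AddCircle.measurePreserving_mk (2 * π) 0)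
  rw [zero_add] at h
  exact h.mono_measure (Measure.restrict_mono Ioo_subset_Ioc_self le_rfl)

theorem exists_lift {g : ℝ → ℂ} (hg : MemLp g 2 (volume.restrict (Ioo 0 (2 * π)))) :
    ∃ η : L2per, lift η =ᵐ[volume.restrict (Ioo 0 (2 * π))] g := by
  rw [restrict_Ioo_eq_restrict_Ioc] at hg ⊢
  set G : Torus → ℂ := AddCircle.liftIoc (2 * π) 0 g with hG
  have e : lift G =ᵐ[volume.restrict (Ioc 0 (2 * π))] g := by
    rw [EventuallyEq, ae_restrict_iff' measurableSet_Ioc]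
    filter_upwards with x hx
    exact AddCircle.liftIoc_zero_coe_apply hx
  have hs : AEStronglyMeasurable G volume := by
    have hm := (AddCircle.measurePreserving_equivIoc (T := 2 * π) (a := 0))
    have h1 : AEStronglyMeasurable (fun x : Ioc (0 : ℝ) (0 + 2 * π) => g x)
        (Measure.comap Subtype.val volume) := by
      have := hg.1
      rw [← zero_add (2 * π)] at this
      rw [← map_comap_subtype_coe measurableSet_Ioc] at this
      exact this.comp_measurable measurable_subtype_coe
    exact h1.comp_measurePreserving hm
  have hmp := AddCircle.measurePreserving_mk (2 * π) 0
  rw [zero_add] at hmp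
  have hGm : MemLp G 2 volume := by
    have h2 : MemLp (lift G) 2 (volume.restrict (Ioc 0 (2 * π))) := hg.ae_eq e.symm
    rw [← hmp.map_eq] at hs ⊢
    exact (memLp_map_measure_iff hs hmp.aemeasurable).2 h2
  refine ⟨hGm.toLp, EventuallyEq.trans ?_ e⟩
  exact (lift_ae hGm.coeFn_toLp).filter_mono (ae_mono Measure.restrict_le_self)

theorem eq_of_lift {f g : L2per} (h : lift f =ᵐ[volume.restrict (Ioo 0 (2 * π))] lift g) :
    f = g := by
  rw [restrict_Ioo_eq_restrict_Ioc] at h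
  have hmp := AddCircle.measurePreserving_mk (2 * π) 0
  rw [zero_add] at hmp
  apply Lp.ext
  have hs : MeasurableSet {x | f x = g x} :=
    measurableSet_eq_fun (Lp.stronglyMeasurable f).measurable (Lp.stronglyMeasurable g).measurable
  have key : ∀ᵐ x ∂(Measure.map ((↑) : ℝ → Torus) (volume.restrict (Ioc 0 (2 * π)))),
      f x = g x := (ae_map_iff hmp.aemeasurable hs).2 h
  rwa [congrArg ae hmp.map_eq] at key

theorem exists_negSecondDeriv {γ : WithTop ℝ} (ζ : deltaDomain γ) :
    ∃ η : L2per, IsNegSecondDeriv ζ η := by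
  have h := ζ.2.2.2.1 0
  simp only [Int.cast_zero, mul_zero, zero_mul, zero_add, mul_one] at h
  obtain ⟨g, hg, hw⟩ := h.2 2 le_rfl
  obtain ⟨η, hη⟩ := exists_lift hg.neg
  refine ⟨η, hw.congr (ae_eq_refl _) ?_⟩
  filter_upwards [hη] with x hx
  simp [hx]

theorem IsNegSecondDeriv.unique {ζ η η' : L2per} (h : IsNegSecondDeriv ζ η)
    (h' : IsNegSecondDeriv ζ η') : η = η' := by
  apply eq_of_lift
  filter_upwards [HasWeakDeriv.unique isOpen_Ioo (memLp_lift η).neg (memLp_lift η').neg h h']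
    with x hx
  exact neg_injective hx

theorem IsNegSecondDeriv.add {ζ ζ' η η' : L2per} (h : IsNegSecondDeriv ζ η)
    (h' : IsNegSecondDeriv ζ' η') : IsNegSecondDeriv (ζ + ζ') (η + η') := by
  refine (HasWeakDeriv.add (memLp_lift ζ) (memLp_lift ζ') (memLp_lift η).neg (memLp_lift η').neg
    h h').congr (lift_add ζ ζ' _) ?_
  filter_upwards [lift_add η η' _] with x hx
  simp only [Pi.neg_apply, ← hx, Pi.add_apply]
  ring

theorem IsNegSecondDeriv.smul {ζ η : L2per} (c : ℂ) (h : IsNegSecondDeriv ζ η) :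
    IsNegSecondDeriv (c • ζ) (c • η) := by
  refine (HasWeakDeriv.smul c h).congr (lift_smul c ζ _) ?_
  filter_upwards [lift_smul c η _] with x hx
  simp only [Pi.neg_apply, ← hx, Pi.smul_apply, smul_neg]

/-- The operator `-Δ_γ = -d²/dx²` (derivatives away from `2πℤ`) with domain `D(-Δ_γ)`. -/
def deltaLaplacian (γ : WithTop ℝ) : L2per →ₗ.[ℂ] L2per where
  domain := deltaDomain γ
  toFun :=
    { toFun := fun ζ => (exists_negSecondDeriv ζ).choose
      map_add' := fun ζ ζ' => (exists_negSecondDeriv (ζ + ζ')).choose_spec.unique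
        ((exists_negSecondDeriv ζ).choose_spec.add (exists_negSecondDeriv ζ').choose_spec)
      map_smul' := fun c ζ => (exists_negSecondDeriv (c • ζ)).choose_spec.unique
        ((exists_negSecondDeriv ζ).choose_spec.smul c) }

theorem isNegSecondDeriv_deltaLaplacian {γ : WithTop ℝ} (ζ : (deltaLaplacian γ).domain) :
    IsNegSecondDeriv ζ (deltaLaplacian γ ζ) :=
  (exists_negSecondDeriv ζ).choose_spec

/-! ### Deficiency indices -/

/-- The deficiency subspace `Ker(T* - z)` of a densely defined operator `T`, as a subspace of the
Hilbert space. -/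
def deficiencySubspace {E : Type*} [NormedAddCommGroup E] [InnerProductSpace ℂ E]
    [CompleteSpace E] (T : E →ₗ.[ℂ] E) (z : ℂ) : Submodule ℂ E :=
  (LinearMap.ker (T.adjoint.toFun - z • T.adjoint.domain.subtype)).map T.adjoint.domain.subtype

/-- The dimension of `Ker(T* - z)`; the deficiency indices of `T` are its values at `i`, `-i`. -/
def deficiencyIndex {E : Type*} [NormedAddCommGroup E] [InnerProductSpace ℂ E]
    [CompleteSpace E] (T : E →ₗ.[ℂ] E) (z : ℂ) : Cardinal :=
  Module.rank ℂ (deficiencySubspace T z)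

end PeriodicDelta

end

/-!
Everything is read off from the equation `g'' = -h + m δ` on the torus, where `δ` is the unit
mass at the origin and `m` is a number; in Fourier coefficients, `ĥ(k) = k² ĝ(k) + m / 2π`
(`HasDerivJump`). A pair `(g, h)` is in the graph of

* the adjoint of `A⁰` exactly when this holds for some `m`, since the functions `exp(ikx) - 1` are
  in the domain of `A⁰` and testing against them shows that `ĥ(k) - k² ĝ(k)` does not depend on `k`
  (`exists_hasDerivJump_iff`, `mem_graph_adjoint_restrictedLaplacian`);
* `A` exactly when it holds with `m = 0`, and `A⁰` exactly when moreover `g(0) = 0`;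
* `-Δ_γ` exactly when it holds with `m = γ g(0)`, or with `g(0) = 0` if `γ = +∞`
  (`mem_graph_deltaLaplacian`).

The last point is the analytic part. By the lemma of du Bois-Reymond, a function with weak second
derivative `-h` on `(0, 2π)` is there of the form `g(0) + ∫₀ˣ (β - ∫₀ᵗ h)`, so it has one-sided
derivatives at the ends of the period, and two integrations by parts in its Fourier coefficients
give `m = g'(0+) - g'(0-)`. Conversely, a solution of the equation differs by a constant from a
function of this form.

The deficiency subspaces are then spanned by `∑ exp(ikx) / (k² ∓ i)`. The equation also gives
Green's identity `⟪h, g'⟫ - ⟪g, h'⟫ = m̄ g'(0) - conj (g(0)) m'` (`HasDerivJump.green`, with primes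
for a second pair), and the boundary values `(g(0), m)` are arbitrary in `ℂ²`
(`exists_boundaryValues`). Hence self-adjoint extensions of `A⁰` correspond to the subspaces of
`ℂ²` that are maximal isotropic for this form: the lines `m = γ a` with `γ` real, and `a = 0`.
-/

noncomputable section

namespace PeriodicDelta

/-! ### Fourier coefficients in the Hilbert space of the torus -/

/-- Parseval's identity for the measure of total mass `2π`. -/
theorem hasSum_inner_fourierCoeff (f g : L2per) :
    HasSum (fun k => starRingEnd ℂ (fourierCoeff ⇑f k) * fourierCoeff ⇑g k)
      (inner ℂ f g / (2 * π)) := by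
  have mf := MeasureTheory.MemLp.haarAddCircle (Lp.memLp f)
  have mg := MeasureTheory.MemLp.haarAddCircle (Lp.memLp g)
  have h := (fourierBasis (T := 2 * π)).hasSum_inner_mul_inner (mf.toLp f) (mg.toLp g)
  have e : inner ℂ (mf.toLp f) (mg.toLp g) = inner ℂ f g / (2 * π) := by
    rw [L2.inner_def, L2.inner_def]
    have : ∫ x, inner ℂ (mf.toLp f x) (mg.toLp g x) ∂AddCircle.haarAddCircle (T := 2 * π) =
        ∫ x, inner ℂ (f x) (g x) ∂AddCircle.haarAddCircle (T := 2 * π) := by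
      refine integral_congr_ae ?_
      filter_upwards [mf.coeFn_toLp, mg.coeFn_toLp] with x h1 h2
      rw [h1, h2]
    rw [this, AddCircle.integral_haarAddCircle, Complex.real_smul, div_eq_inv_mul]
    push_cast
    rfl
  rw [e] at h
  refine h.congr_fun fun k => ?_
  rw [← inner_conj_symm, ← HilbertBasis.repr_apply_apply, ← HilbertBasis.repr_apply_apply,
    fourierBasis_repr, fourierBasis_repr, fourierCoeff_congr_ae mf.coeFn_toLp,
    fourierCoeff_congr_ae mg.coeFn_toLp]

theorem summable_sq_fourierCoeff (f : L2per) : Summable fun k => ‖fourierCoeff ⇑f k‖ ^ 2 := by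
  have h := (hasSum_inner_fourierCoeff f f).summable.norm
  refine h.congr fun k => ?_
  rw [norm_mul, RCLike.norm_conj, sq]

theorem exists_fourierCoeff_single (n : ℤ) :
    ∃ f : L2per, ∀ k, fourierCoeff ⇑f k = if k = n then 1 else 0 := by
  refine exists_fourierCoeff (summable_of_ne_finset_zero (s := {n}) fun k hk => ?_)
  simp only [Finset.mem_singleton] at hk
  simp [hk]

/-- The exponential `x ↦ exp(inx)`, through its Fourier coefficients. -/
def mode (n : ℤ) : L2per := (exists_fourierCoeff_single n).choose

theorem fourierCoeff_mode (n k : ℤ) : fourierCoeff ⇑(mode n) k = if k = n then 1 else 0 :=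
  (exists_fourierCoeff_single n).choose_spec k

theorem inner_mode (f : L2per) (n : ℤ) :
    inner ℂ f (mode n) = 2 * π * starRingEnd ℂ (fourierCoeff ⇑f n) := by
  have h := hasSum_inner_fourierCoeff f (mode n)
  have h' : HasSum (fun k => starRingEnd ℂ (fourierCoeff ⇑f k) * fourierCoeff ⇑(mode n) k)
      (starRingEnd ℂ (fourierCoeff ⇑f n) * fourierCoeff ⇑(mode n) n) := by
    refine hasSum_single n fun k hk => ?_
    rw [fourierCoeff_mode, if_neg hk, mul_zero]
  have e := h.unique h'
  rw [fourierCoeff_mode, if_pos rfl, mul_one] at e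
  have hp : (2 * π : ℂ) ≠ 0 := by exact_mod_cast Real.two_pi_pos.ne'
  rw [← e, mul_div_cancel₀ _ hp]

theorem summable_inv_one_add_sq : Summable fun k : ℤ => (1 / (1 + (k : ℝ) ^ 2)) := by
  have h : Summable fun k : ℤ => 1 / (k : ℝ) ^ 2 :=
    Real.summable_one_div_int_pow.2 (by norm_num)
  refine Summable.of_norm_bounded_eventually h ?_
  refine (Set.finite_singleton (0 : ℤ)).subset fun k hk => ?_
  by_contra hk0
  apply hk
  have : (0 : ℝ) < (k : ℝ) ^ 2 := by
    have : (k : ℝ) ≠ 0 := by exact_mod_cast hk0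
    positivity
  change ‖1 / (1 + (k : ℝ) ^ 2)‖ ≤ _
  rw [Real.norm_of_nonneg (by positivity)]
  exact one_div_le_one_div_of_le this (by linarith)

/-! ### The equation `g'' = -h + m δ` on the torus -/

/-- `g'' = -h + m δ` as periodic distributions, where `δ` is the unit mass at the origin: since
all Fourier coefficients of `δ` are `1 / 2π`, this says `ĥ(k) = k² ĝ(k) + m / 2π`. The number `m`
is the jump of `g'` at the origin. -/
def HasDerivJump (g h : L2per) (m : ℂ) : Prop :=
  ∀ k : ℤ, fourierCoeff ⇑h k = (k : ℂ) ^ 2 * fourierCoeff ⇑g k + m / (2 * π)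

/-- The value at the origin of the continuous representative of `g`, as the sum of the Fourier
series (meaningful when the Fourier coefficients are summable). -/
def valueAtZero (g : L2per) : ℂ := ∑' k : ℤ, fourierCoeff ⇑g k

theorem HasDerivJump.one_add_sq_mul {g h : L2per} {m : ℂ} (H : HasDerivJump g h m) (k : ℤ) :
    (1 + (k : ℂ) ^ 2) * fourierCoeff ⇑g k = fourierCoeff ⇑(h + g) k - m / (2 * π) := by
  rw [fourierCoeff_add, H k]
  ring

theorem norm_one_add_sq (k : ℤ) : ‖(1 + (k : ℂ) ^ 2)‖ = 1 + (k : ℝ) ^ 2 := by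
  have : (1 + (k : ℂ) ^ 2) = ((1 + (k : ℝ) ^ 2 : ℝ) : ℂ) := by push_cast; rfl
  rw [this, Complex.norm_real, Real.norm_of_nonneg (by positivity)]

theorem HasDerivJump.norm_sq_le {g h : L2per} {m : ℂ} (H : HasDerivJump g h m) (k : ℤ) :
    (1 + (k : ℝ) ^ 2) ^ 1 * ‖fourierCoeff ⇑g k‖ ^ 2 ≤
      2 * ‖fourierCoeff ⇑(h + g) k‖ ^ 2 +
        2 * ‖m / (2 * π)‖ ^ 2 * (1 / (1 + (k : ℝ) ^ 2)) := by
  have e := congrArg norm (H.one_add_sq_mul k)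
  rw [norm_mul, norm_one_add_sq] at e
  have hs := norm_sub_le (fourierCoeff ⇑(h + g) k) (m / (2 * π))
  rw [← e] at hs
  set a := ‖fourierCoeff ⇑g k‖
  set b := ‖fourierCoeff ⇑(h + g) k‖
  set c := ‖m / (2 * π)‖
  have hk : (1 : ℝ) ≤ 1 + (k : ℝ) ^ 2 := by nlinarith [sq_nonneg (k : ℝ)]
  set w := 1 + (k : ℝ) ^ 2
  have hw : 0 < w := by linarith
  have ha : 0 ≤ a := norm_nonneg _
  have h1 : (w * a) ^ 2 ≤ 2 * b ^ 2 + 2 * c ^ 2 := by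
    have : (w * a) ^ 2 ≤ (b + c) ^ 2 := by gcongr
    nlinarith [sq_nonneg (b - c)]
  have h2 : w * (w ^ 1 * a ^ 2) ≤ w * (2 * b ^ 2 + 2 * c ^ 2 * (1 / w)) := by
    have : w * (2 * b ^ 2 + 2 * c ^ 2 * (1 / w)) = w * (2 * b ^ 2) + 2 * c ^ 2 := by
      field_simp
    rw [this]
    nlinarith [sq_nonneg b]
  exact le_of_mul_le_mul_left h2 hw

/-- A solution of `g'' = -h + m δ` is in `H¹`. -/
theorem HasDerivJump.mem_Hper_one {g h : L2per} {m : ℂ} (H : HasDerivJump g h m) :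
    g ∈ Hper 1 :=
  Summable.of_nonneg_of_le (fun k => by positivity) H.norm_sq_le
    (((summable_sq_fourierCoeff (h + g)).mul_left 2).add (summable_inv_one_add_sq.mul_left _))

theorem HasDerivJump.summable {g h : L2per} {m : ℂ} (H : HasDerivJump g h m) :
    Summable (fourierCoeff ⇑g) := by
  have h1 : Summable fun k : ℤ => (1 + (k : ℝ) ^ 2) ^ 1 * ‖fourierCoeff ⇑g k‖ ^ 2 :=
    H.mem_Hper_one
  refine Summable.of_norm_bounded (h1.add summable_inv_one_add_sq) fun k => ?_
  have hw : (0 : ℝ) < 1 + (k : ℝ) ^ 2 := by positivity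
  set w := 1 + (k : ℝ) ^ 2
  set a := ‖fourierCoeff ⇑g k‖
  have ha : 0 ≤ a := norm_nonneg _
  have h2 : 2 * a ≤ w ^ 1 * a ^ 2 + 1 / w := by
    have : w ^ 1 * a ^ 2 + 1 / w - 2 * a = (w * a - 1) ^ 2 / w := by field_simp; ring
    have := div_nonneg (sq_nonneg (w * a - 1)) hw.le
    linarith
  linarith

/-- Green's identity, with the boundary terms at the origin. -/
theorem HasDerivJump.green {g h g' h' : L2per} {m m' : ℂ} (H : HasDerivJump g h m)
    (H' : HasDerivJump g' h' m') :
    inner ℂ h g' - inner ℂ g h' =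
      starRingEnd ℂ m * valueAtZero g' - starRingEnd ℂ (valueAtZero g) * m' := by
  have h1 := (hasSum_inner_fourierCoeff h g').sub (hasSum_inner_fourierCoeff g h')
  have h2 := (H'.summable.hasSum.mul_left (starRingEnd ℂ (m / (2 * π)))).sub
    ((Complex.hasSum_conj'.2 H.summable.hasSum).mul_right (m' / (2 * π)))
  have e := h1.unique (h2.congr_fun fun k => by
    rw [H k, H' k]
    simp only [map_add, map_mul, map_pow, map_intCast]
    ring)
  have hp : (2 * π : ℂ) ≠ 0 := by exact_mod_cast Real.two_pi_pos.ne'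
  have hc : starRingEnd ℂ (2 * π : ℂ) = 2 * π := by
    rw [map_mul, Complex.conj_ofReal, map_ofNat]
  rw [map_div₀, hc, ← sub_div] at e
  change _ = starRingEnd ℂ m / (2 * π) * valueAtZero g' -
    starRingEnd ℂ (valueAtZero g) * (m' / (2 * π)) at e
  field_simp at e
  linear_combination e

theorem HasDerivJump.add {g h g' h' : L2per} {m m' : ℂ} (H : HasDerivJump g h m)
    (H' : HasDerivJump g' h' m') : HasDerivJump (g + g') (h + h') (m + m') := by
  intro k
  rw [fourierCoeff_add, fourierCoeff_add, H k, H' k]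
  ring

theorem HasDerivJump.smul {g h : L2per} {m : ℂ} (c : ℂ) (H : HasDerivJump g h m) :
    HasDerivJump (c • g) (c • h) (c * m) := by
  intro k
  rw [fourierCoeff_smul, fourierCoeff_smul, H k]
  ring

theorem valueAtZero_add {g g' : L2per} (hg : Summable (fourierCoeff ⇑g))
    (hg' : Summable (fourierCoeff ⇑g')) :
    valueAtZero (g + g') = valueAtZero g + valueAtZero g' := by
  simp only [valueAtZero, fourierCoeff_add]
  exact hg.tsum_add hg'

theorem valueAtZero_smul (c : ℂ) (g : L2per) : valueAtZero (c • g) = c * valueAtZero g := by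
  simp only [valueAtZero, fourierCoeff_smul]
  exact tsum_mul_left

/-- A nonzero constant sequence is not square summable, so `δ` is not in `L²`. -/
theorem eq_zero_of_fourierCoeff_const {f : L2per} {c : ℂ} (h : ∀ k, fourierCoeff ⇑f k = c) :
    c = 0 := by
  have := summable_sq_fourierCoeff f
  simp only [h] at this
  simpa using (summable_const_iff _).1 this

theorem valueAtZero_mode (n : ℤ) : valueAtZero (mode n) = 1 := by
  simp only [valueAtZero, fourierCoeff_mode]
  exact tsum_ite_eq n _

theorem hasDerivJump_mode (n : ℤ) : HasDerivJump (mode n) ((n : ℂ) ^ 2 • mode n) 0 := by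
  intro k
  rw [fourierCoeff_smul, fourierCoeff_mode]
  split_ifs with h <;> simp [h]

/-- The pairs `(g, h)` that are formally adjoint to `-d²/dx²` on the `H²` functions vanishing at
the origin are the solutions of `g'' = -h + m δ`: testing against `exp(ikx) - 1` shows that
`ĥ(k) - k² ĝ(k)` does not depend on `k`. -/
theorem exists_hasDerivJump_iff {g h : L2per} :
    (∃ m, HasDerivJump g h m) ↔
      ∀ f f' : L2per, HasDerivJump f f' 0 → valueAtZero f = 0 → inner ℂ h f = inner ℂ g f' := by
  have hp : (2 * π : ℂ) ≠ 0 := by exact_mod_cast Real.two_pi_pos.ne'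
  constructor
  · rintro ⟨m, H⟩ f f' hf hf0
    have := H.green hf
    rw [hf0] at this
    linear_combination this
  · intro H
    refine ⟨2 * π * fourierCoeff ⇑h 0, fun k => ?_⟩
    have hj := (hasDerivJump_mode k).add ((hasDerivJump_mode 0).smul (-1))
    have h1 := H _ _ (by rwa [mul_zero, add_zero] at hj) (by
      rw [valueAtZero_add (hasDerivJump_mode k).summable ((hasDerivJump_mode 0).smul (-1)).summable,
        valueAtZero_smul, valueAtZero_mode, valueAtZero_mode]
      ring)
    rw [inner_add_right, inner_add_right] at h1
    simp only [inner_smul_right, inner_mode] at h1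
    have h2 : (starRingEnd ℂ (fourierCoeff ⇑h k) - starRingEnd ℂ (fourierCoeff ⇑h 0)) =
        (k : ℂ) ^ 2 * starRingEnd ℂ (fourierCoeff ⇑g k) := by
      apply mul_left_cancel₀ hp
      push_cast at h1
      linear_combination h1
    have h3 := congrArg (starRingEnd ℂ) h2
    simp only [map_sub, map_mul, map_pow, Complex.conj_conj, map_intCast] at h3
    field_simp
    linear_combination h3

/-- The resolvent kernel `∑ exp(ikx) / (k² - z)`, which solves `g'' = -z g - 2π δ`, for
`z = ± i`. -/
theorem exists_greenFunction {z : ℂ} (hz : z ^ 2 = -1) :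
    ∃ g : L2per, (∀ k : ℤ, ((k : ℂ) ^ 2 - z) * fourierCoeff ⇑g k = 1) ∧
      HasDerivJump g (z • g) (-(2 * π)) := by
  have hn : ∀ k : ℤ, ((k : ℂ) ^ 2 - z) * ((k : ℂ) ^ 2 + z) = ((k ^ 4 + 1 : ℝ) : ℂ) := by
    intro k
    push_cast
    linear_combination -hz
  have h0 : ∀ k : ℤ, (k : ℂ) ^ 2 - z ≠ 0 := by
    intro k h
    have := hn k
    rw [h, zero_mul, eq_comm, Complex.ofReal_eq_zero] at this
    have : (0 : ℝ) < (k : ℝ) ^ 4 + 1 := by positivity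
    linarith
  have hz1 : ‖z‖ = 1 := by
    have := congrArg norm hz
    rw [norm_pow, norm_neg, norm_one] at this
    exact (pow_eq_one_iff_of_nonneg (norm_nonneg z) two_ne_zero).1 this
  obtain ⟨g, hg⟩ := exists_fourierCoeff (a := fun k => 1 / ((k : ℂ) ^ 2 - z)) (by
    refine Summable.of_nonneg_of_le (fun k => by positivity) (fun k => ?_)
      (summable_inv_one_add_sq.mul_left 4)
    have h1 := congrArg norm (hn k)
    rw [norm_mul, Complex.norm_real, Real.norm_of_nonneg (by positivity)] at h1
    have h2 : ‖(k : ℂ) ^ 2 + z‖ ≤ (k : ℝ) ^ 2 + 1 := by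
      refine (norm_add_le _ _).trans ?_
      rw [norm_pow, Complex.norm_intCast, sq_abs, hz1]
    have hd : 0 < ‖(k : ℂ) ^ 2 - z‖ := norm_pos_iff.2 (h0 k)
    rw [norm_div, norm_one, div_pow, one_pow, mul_one_div, div_le_div_iff₀ (by positivity)
      (by positivity)]
    set d := ‖(k : ℂ) ^ 2 - z‖
    set e := ‖(k : ℂ) ^ 2 + z‖
    set q := (k : ℝ) ^ 2 with hq
    have hq0 : 0 ≤ q := sq_nonneg _
    have h4 : (k : ℝ) ^ 4 = q ^ 2 := by rw [hq]; ring
    rw [h4] at h1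
    have h5 : (q + 1) ≤ 2 * d := by
      have : (q + 1) * (q + 1) ≤ 2 * d * (q + 1) := by
        nlinarith [mul_le_mul_of_nonneg_left h2 hd.le, sq_nonneg (q - 1)]
      exact le_of_mul_le_mul_right this (by linarith)
    nlinarith)
  refine ⟨g, fun k => by rw [hg]; exact mul_one_div_cancel (h0 k), fun k => ?_⟩
  have hp : (2 * π : ℂ) ≠ 0 := by exact_mod_cast Real.two_pi_pos.ne'
  rw [fourierCoeff_smul, hg, neg_div, div_self hp]
  have := h0 k
  field_simp
  ring

/-! ### Weak derivatives on an interval -/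

/-- Integration by parts against a primitive of an integrable function, which need not be
differentiable everywhere; by Fubini's theorem on the triangle `t ≤ x`. -/
theorem integral_deriv_mul_primitive {a b : ℝ} (hab : a ≤ b) {θ θ' p : ℝ → ℂ}
    (hθ : ∀ x, HasDerivAt θ (θ' x) x) (hθ' : Continuous θ')
    (hp : IntervalIntegrable p volume a b) (C : ℂ) :
    ∫ x in a..b, θ' x * (C + ∫ t in a..x, p t) =
      θ b * (C + ∫ t in a..b, p t) - θ a * C - ∫ x in a..b, θ x * p x := by
  have hft : ∀ x y, ∫ t in x..y, θ' t = θ y - θ x := fun x y =>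
    intervalIntegral.integral_eq_sub_of_hasDerivAt (fun t _ => hθ t)
      (hθ'.intervalIntegrable _ _)
  have hcθ : Continuous θ := continuous_iff_continuousAt.2 fun x => (hθ x).continuousAt
  have hpI : IntegrableOn p (Ioc a b) := (intervalIntegrable_iff_integrableOn_Ioc_of_le hab).1 hp
  have hθI : IntegrableOn θ' (Ioc a b) :=
    (intervalIntegrable_iff_integrableOn_Ioc_of_le hab).1 (hθ'.intervalIntegrable _ _)
  have hprod : Integrable (fun z : ℝ × ℝ => {z : ℝ × ℝ | z.2 ≤ z.1}.indicator
      (fun z => θ' z.1 * p z.2) z)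
      ((volume.restrict (Ioc a b)).prod (volume.restrict (Ioc a b))) :=
    (hθI.mul_prod hpI).indicator (measurableSet_le measurable_snd measurable_fst)
  have hswap := integral_integral_swap
    (f := fun x t => {z : ℝ × ℝ | z.2 ≤ z.1}.indicator (fun z => θ' z.1 * p z.2) (x, t)) hprod
  have h1 : ∀ x ∈ Ioc a b, ∫ t in Ioc a b, {z : ℝ × ℝ | z.2 ≤ z.1}.indicator
      (fun z => θ' z.1 * p z.2) (x, t) = θ' x * ∫ t in a..x, p t := by
    intro x hx
    have : ∀ t, {z : ℝ × ℝ | z.2 ≤ z.1}.indicator (fun z => θ' z.1 * p z.2) (x, t) =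
        (Iic x).indicator (fun t => θ' x * p t) t := fun t => by
      by_cases h : t ≤ x <;> simp [indicator, h]
    simp only [this]
    rw [setIntegral_indicator measurableSet_Iic, Ioc_inter_Iic, min_eq_right hx.2,
      ← intervalIntegral.integral_of_le hx.1.le, intervalIntegral.integral_const_mul]
  have h2 : ∀ t ∈ Ioc a b, ∫ x in Ioc a b, {z : ℝ × ℝ | z.2 ≤ z.1}.indicator
      (fun z => θ' z.1 * p z.2) (x, t) = θ b * p t - θ t * p t := by
    intro t ht
    have : ∀ x, {z : ℝ × ℝ | z.2 ≤ z.1}.indicator (fun z => θ' z.1 * p z.2) (x, t) =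
        (Ici t).indicator (fun x => θ' x * p t) x := fun x => by
      by_cases h : t ≤ x <;> simp [indicator, h]
    simp only [this]
    have hs : Ioc a b ∩ Ici t = Icc t b := by
      ext x
      simp only [mem_inter_iff, mem_Ioc, mem_Ici, mem_Icc]
      exact ⟨fun h => ⟨h.2, h.1.2⟩, fun h => ⟨⟨ht.1.trans_le h.1, h.2⟩, h.1⟩⟩
    rw [setIntegral_indicator measurableSet_Ici, hs, integral_Icc_eq_integral_Ioc,
      ← intervalIntegral.integral_of_le ht.2, intervalIntegral.integral_mul_const, hft, sub_mul]
  rw [setIntegral_congr_fun measurableSet_Ioc h1, setIntegral_congr_fun measurableSet_Ioc h2,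
    ← intervalIntegral.integral_of_le hab, ← intervalIntegral.integral_of_le hab,
    intervalIntegral.integral_sub (hp.const_mul _) (hp.continuousOn_mul hcθ.continuousOn),
    intervalIntegral.integral_const_mul] at hswap
  have hprim : ContinuousOn (fun x => ∫ t in a..x, p t) (uIcc a b) :=
    intervalIntegral.continuousOn_primitive_interval' hp left_mem_uIcc
  have hadd := intervalIntegral.integral_add
    ((hθ'.mul continuous_const).intervalIntegrable (μ := volume) a b :
      IntervalIntegrable (fun x => θ' x * C) volume a b)
    ((hθ'.continuousOn.mul hprim).intervalIntegrable :
      IntervalIntegrable (fun x => θ' x * ∫ t in a..x, p t) volume a b)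
  simp only [Pi.mul_apply] at hadd
  simp only [mul_add]
  rw [hadd, hswap, intervalIntegral.integral_mul_const, hft]
  ring

theorem eq_zero_of_tsupport_subset {Ω : Set ℝ} {φ : ℝ → ℝ} (h : tsupport φ ⊆ Ω) {x : ℝ}
    (hx : x ∉ Ω) : φ x = 0 :=
  image_eq_zero_of_notMem_tsupport fun hx' => hx (h hx')

theorem tsupport_deriv_subset {Ω : Set ℝ} {φ : ℝ → ℝ} (h : tsupport φ ⊆ Ω) :
    tsupport (deriv φ) ⊆ Ω :=
  (closure_minimal (support_deriv_subset (f := φ)) (isClosed_tsupport φ)).trans h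

theorem contDiff_deriv {φ : ℝ → ℝ} (h : ContDiff ℝ ∞ φ) : ContDiff ℝ ∞ (deriv φ) :=
  (contDiff_infty_iff_deriv.1 h).2

theorem hasWeakDeriv_one_of_primitive {a b : ℝ} (hab : a ≤ b) {f p : ℝ → ℂ}
    (hp : IntervalIntegrable p volume a b) {C : ℂ}
    (hf : ∀ x ∈ Ioo a b, f x = C + ∫ t in a..x, p t) : HasWeakDeriv (Ioo a b) 1 f p := by
  intro φ hφ _ hs
  have hd : ∀ x, HasDerivAt (fun x => (φ x : ℂ)) ((deriv φ x : ℝ) : ℂ) x := fun x =>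
    ((hφ.differentiable (by simp)).differentiableAt.hasDerivAt (x := x)).ofReal_comp
  have h := integral_deriv_mul_primitive hab hd
    (Complex.continuous_ofReal.comp (contDiff_deriv hφ).continuous) hp C
  have ha : φ a = 0 := eq_zero_of_tsupport_subset hs (by simp)
  have hb : φ b = 0 := eq_zero_of_tsupport_subset hs (by simp)
  rw [ha, hb, Complex.ofReal_zero, zero_mul, zero_mul, sub_zero, zero_sub,
    intervalIntegral.integral_of_le hab, intervalIntegral.integral_of_le hab,
    integral_Ioc_eq_integral_Ioo, integral_Ioc_eq_integral_Ioo] at h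
  rw [iteratedDeriv_one, pow_one, neg_one_mul]
  simp only [Complex.real_smul]
  rw [← h]
  refine setIntegral_congr_fun measurableSet_Ioo fun x hx => ?_
  simp only [hf x hx]

theorem HasWeakDeriv.comp {Ω : Set ℝ} {f v w : ℝ → ℂ} (h₁ : HasWeakDeriv Ω 1 f v)
    (h₂ : HasWeakDeriv Ω 1 v w) : HasWeakDeriv Ω 2 f w := by
  intro φ hφ hc hs
  have e₁ := h₁ (deriv φ) (contDiff_deriv hφ) hc.deriv (tsupport_deriv_subset hs)
  have e₂ := h₂ φ hφ hc hs
  rw [iteratedDeriv_one] at e₁ e₂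
  rw [iteratedDeriv_succ, iteratedDeriv_one, e₁, e₂]
  ring

theorem setIntegral_smul_eq {Ω Ω' : Set ℝ} (hm : MeasurableSet Ω') (h : Ω ⊆ Ω') {φ : ℝ → ℝ}
    (hs : tsupport φ ⊆ Ω) (f : ℝ → ℂ) : ∫ x in Ω', φ x • f x = ∫ x in Ω, φ x • f x := by
  refine (setIntegral_eq_of_subset_of_forall_sdiff_eq_zero hm h fun x hx => ?_)
  rw [eq_zero_of_tsupport_subset hs hx.2, zero_smul]

theorem tsupport_iteratedDeriv_subset {Ω : Set ℝ} {φ : ℝ → ℝ} (h : tsupport φ ⊆ Ω) (n : ℕ) :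
    tsupport (iteratedDeriv n φ) ⊆ Ω := by
  induction n with
  | zero => simpa using h
  | succ n ih => rw [iteratedDeriv_succ]; exact tsupport_deriv_subset ih

theorem HasWeakDeriv.mono {Ω Ω' : Set ℝ} (hm : MeasurableSet Ω') (h : Ω ⊆ Ω') {n : ℕ}
    {f g : ℝ → ℂ} (H : HasWeakDeriv Ω' n f g) : HasWeakDeriv Ω n f g := by
  intro φ hφ hc hs
  have := H φ hφ hc (hs.trans h)
  rwa [setIntegral_smul_eq hm h (tsupport_iteratedDeriv_subset hs n),
    setIntegral_smul_eq hm h hs] at this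

theorem hasWeakDeriv_zero (Ω : Set ℝ) (f : ℝ → ℂ) : HasWeakDeriv Ω 0 f f := by
  intro φ _ _ _
  simp

/-- Weak derivatives on the two sides of a point combine to a weak derivative off that point:
a test function splits into its restrictions to the two sides. -/
theorem HasWeakDeriv.union {Ω : Set ℝ} (hm : MeasurableSet Ω) {c : ℝ} (hc : c ∉ Ω) {n : ℕ}
    {f g : ℝ → ℂ} (hf : MemLp f 2 (volume.restrict Ω)) (hg : MemLp g 2 (volume.restrict Ω))
    (h₁ : HasWeakDeriv (Ω ∩ Iio c) n f g) (h₂ : HasWeakDeriv (Ω ∩ Ioi c) n f g) :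
    HasWeakDeriv Ω n f g := by
  intro φ hφ hcs hs
  have hcφ : c ∉ tsupport φ := fun h => hc (hs h)
  have hφ0 : φ =ᶠ[𝓝 c] 0 := notMem_tsupport_iff_eventuallyEq.1 hcφ
  have key : ∀ s : Set ℝ, IsOpen s → (∀ x, x ≠ c → x ∉ s → sᶜ ∈ 𝓝 x) →
      ContDiff ℝ ∞ (s.indicator φ) ∧ HasCompactSupport (s.indicator φ) ∧
        (c ∉ s → tsupport (s.indicator φ) ⊆ Ω ∩ s) := by
    intro s hs1 hs2
    have hsub : tsupport (s.indicator φ) ⊆ tsupport φ :=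
      closure_mono (by rw [support_indicator]; exact inter_subset_right)
    refine ⟨contDiff_iff_contDiffAt.2 fun x => ?_,
      hcs.of_isClosed_subset (isClosed_tsupport _) hsub, fun hcs' x hx => ⟨hs (hsub hx), ?_⟩⟩
    · by_cases hxc : x = c
      · subst hxc
        refine contDiffAt_const (c := (0 : ℝ)) |>.congr_of_eventuallyEq ?_
        filter_upwards [hφ0] with y hy
        by_cases hy' : y ∈ s <;> simp [hy', hy]
      · by_cases hxs : x ∈ s
        · refine hφ.contDiffAt.congr_of_eventuallyEq ?_
          filter_upwards [hs1.mem_nhds hxs] with y hy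
          simp [hy]
        · refine contDiffAt_const (c := (0 : ℝ)) |>.congr_of_eventuallyEq ?_
          filter_upwards [hs2 x hxc hxs] with y hy
          exact indicator_of_notMem hy φ
    · by_contra hxs
      have hxc : x ≠ c := fun h => hcφ (h ▸ hsub hx)
      refine (notMem_tsupport_iff_eventuallyEq.2 ?_) hx
      filter_upwards [hs2 x hxc hxs] with y hy
      exact indicator_of_notMem hy φ
  obtain ⟨a1, a2, a3⟩ := key (Iio c) isOpen_Iio fun x hx hx' => by
    rw [compl_Iio]
    exact Ici_mem_nhds (lt_of_le_of_ne (not_lt.1 hx') (Ne.symm hx))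
  obtain ⟨b1, b2, b3⟩ := key (Ioi c) isOpen_Ioi fun x hx hx' => by
    rw [compl_Ioi]
    exact Iic_mem_nhds (lt_of_le_of_ne (not_lt.1 hx') hx)
  have a3 := a3 (by simp)
  have b3 := b3 (by simp)
  have hsum : φ = (Iio c).indicator φ + (Ioi c).indicator φ := by
    ext x
    rcases lt_trichotomy x c with h | h | h
    · simp [h, h.le]
    · subst h
      simp [hφ0.eq_of_nhds]
    · simp [h, h.le]
  have eA := h₁ _ a1 a2 a3
  have eB := h₂ _ b1 b2 b3
  rw [← setIntegral_smul_eq hm inter_subset_left (tsupport_iteratedDeriv_subset a3 n),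
    ← setIntegral_smul_eq hm inter_subset_left a3] at eA
  rw [← setIntegral_smul_eq hm inter_subset_left (tsupport_iteratedDeriv_subset b3 n),
    ← setIntegral_smul_eq hm inter_subset_left b3] at eB
  have i1 := integral_add (integrable_test hf n a1 a2) (integrable_test hf n b1 b2)
  have i2 := integral_add (integrable_test hg 0 a1 a2) (integrable_test hg 0 b1 b2)
  simp only [iteratedDeriv_zero] at i2
  have hd : ∀ x, iteratedDeriv n φ x =
      iteratedDeriv n ((Iio c).indicator φ) x + iteratedDeriv n ((Ioi c).indicator φ) x := by
    intro x
    conv_lhs => rw [hsum]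
    exact iteratedDeriv_add (a1.contDiffAt.of_le (by exact_mod_cast le_top))
      (b1.contDiffAt.of_le (by exact_mod_cast le_top))
  have hv : ∀ x, φ x = (Iio c).indicator φ x + (Ioi c).indicator φ x := fun x => congrFun hsum x
  simp only [hd, add_smul]
  rw [i1, eA, eB, ← mul_add, ← i2]
  simp only [← add_smul, ← hv]

/-- Weak derivatives of a periodic function on translates of an interval. -/
theorem HasWeakDeriv.translate {a b T : ℝ} {n : ℕ} {f g : ℝ → ℂ} (hf : ∀ x, f (x + T) = f x)
    (hg : ∀ x, g (x + T) = g x) (H : HasWeakDeriv (Ioo a b) n f g) :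
    HasWeakDeriv (Ioo (a + T) (b + T)) n f g := by
  intro φ hφ hc hs
  have hshift : ∀ F : ℝ → ℂ, ∫ x in Ioo (a + T) (b + T), F x = ∫ x in Ioo a b, F (x + T) := by
    intro F
    have := (measurePreserving_add_right volume T).setIntegral_preimage_emb
      (measurableEmbedding_addRight T) F (Ioo (a + T) (b + T))
    rw [← this]
    congr 2
    ext x
    simp
  have hφ' : ContDiff ℝ ∞ (fun x => φ (x + T)) := hφ.comp (contDiff_id.add contDiff_const)
  have hc' : HasCompactSupport (fun x => φ (x + T)) :=
    hc.comp_homeomorph (Homeomorph.addRight T)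
  have hs' : tsupport (fun x => φ (x + T)) ⊆ Ioo a b := by
    have h1 : tsupport (fun x => φ (x + T)) = (Homeomorph.addRight T) ⁻¹' tsupport φ :=
      tsupport_comp_eq_preimage φ (Homeomorph.addRight T)
    rw [h1]
    intro x hx
    have := hs hx
    simpa using this
  have h := H _ hφ' hc' hs'
  rw [hshift, hshift]
  simp only [hf, hg]
  rw [← h]
  simp only [iteratedDeriv_comp_add_const]

/-! ### Functions with vanishing weak second derivative -/

/-- A test function of mean zero is the derivative of a test function. -/
theorem exists_deriv_eq_of_integral_eq_zero {a b : ℝ} {θ : ℝ → ℝ} (hθ : ContDiff ℝ ∞ θ)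
    (hc : HasCompactSupport θ) (hs : tsupport θ ⊆ Ioo a b) (h0 : ∫ x, θ x = 0) :
    ∃ φ : ℝ → ℝ, ContDiff ℝ ∞ φ ∧ HasCompactSupport φ ∧ tsupport φ ⊆ Ioo a b ∧ deriv φ = θ := by
  have hd : ∀ x, HasDerivAt (fun x => ∫ t in a..x, θ t) (θ x) x := fun x =>
    intervalIntegral.integral_hasDerivAt_right (hθ.continuous.intervalIntegrable _ _)
      (hθ.continuous.stronglyMeasurableAtFilter _ _) hθ.continuous.continuousAt
  have hderiv : deriv (fun x => ∫ t in a..x, θ t) = θ := funext fun x => (hd x).deriv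
  obtain ⟨c, d, hcd⟩ : ∃ c d, a < c ∧ d < b ∧ tsupport θ ⊆ Icc c d ∧ c ≤ d ∨
      tsupport θ = ∅ := by
    rcases (tsupport θ).eq_empty_or_nonempty with h | h
    · exact ⟨0, 0, Or.inr h⟩
    · obtain ⟨c, hcm, hc'⟩ := hc.isCompact.exists_isLeast h
      obtain ⟨d, hdm, hd'⟩ := hc.isCompact.exists_isGreatest h
      exact ⟨c, d, Or.inl ⟨(hs hcm).1, (hs hdm).2, fun x hx => ⟨hc' hx, hd' hx⟩, hc' hdm⟩⟩
  rcases hcd with ⟨hac, hdb, hsub, hcd⟩ | hemp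
  · have hsupp : tsupport (fun x => ∫ t in a..x, θ t) ⊆ Icc c d := by
      refine closure_minimal (fun x hx => ?_) isClosed_Icc
      by_contra hx'
      apply hx
      have hout : ∀ t, t ∉ Icc c d → θ t = 0 := fun t ht => eq_zero_of_tsupport_subset hsub ht
      rcases lt_or_ge x c with h | h
      · refine intervalIntegral.integral_zero_ae (Eventually.of_forall fun t ht => hout t ?_)
        intro ht'
        have := (mem_uIoc.1 ht)
        rcases this with h1 | h1
        · linarith [ht'.1, h1.2]
        · linarith [ht'.1, h1.2]
      · have hdx : d < x := by
          by_contra h'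
          exact hx' ⟨h, not_lt.1 h'⟩
        change ∫ t in a..x, θ t = 0
        rw [intervalIntegral.integral_of_le (by linarith), ← h0]
        refine setIntegral_eq_integral_of_forall_compl_eq_zero fun t ht => hout t fun ht' => ht ?_
        exact ⟨by linarith [ht'.1], by linarith [ht'.2]⟩
    refine ⟨_, ?_, HasCompactSupport.of_support_subset_isCompact isCompact_Icc
      ((subset_tsupport _).trans hsupp), hsupp.trans fun x hx => ⟨hac.trans_le hx.1,
        hx.2.trans_lt hdb⟩, hderiv⟩
    rw [contDiff_infty_iff_deriv, hderiv]
    exact ⟨fun x => (hd x).differentiableAt, hθ⟩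
  · have hθ0 : θ = 0 := tsupport_eq_empty_iff.1 hemp
    refine ⟨0, contDiff_const, HasCompactSupport.zero, by simp, ?_⟩
    rw [hθ0]
    ext x
    simp

/-- A linear functional on test functions that vanishes on derivatives is a multiple of the
integral. -/
theorem exists_const_of_vanishes_on_deriv {a b : ℝ} (hab : a < b) {Λ : (ℝ → ℝ) → ℂ}
    (hlin : ∀ φ ψ : ℝ → ℝ, ContDiff ℝ ∞ φ → HasCompactSupport φ → ContDiff ℝ ∞ ψ →
      HasCompactSupport ψ → ∀ c : ℝ, Λ (fun x => φ x - c * ψ x) = Λ φ - c * Λ ψ)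
    (h0 : ∀ φ : ℝ → ℝ, ContDiff ℝ ∞ φ → HasCompactSupport φ → tsupport φ ⊆ Ioo a b →
      Λ (deriv φ) = 0) :
    ∃ C : ℂ, ∀ φ : ℝ → ℝ, ContDiff ℝ ∞ φ → HasCompactSupport φ → tsupport φ ⊆ Ioo a b →
      Λ φ = C * ((∫ x, φ x : ℝ) : ℂ) := by
  let B : ContDiffBump ((a + b) / 2) := ⟨(b - a) / 8, (b - a) / 4, by linarith, by linarith⟩
  have hB : ContDiff ℝ ∞ (B.normed volume) := B.contDiff_normed
  have hBc : HasCompactSupport (B.normed volume) := B.hasCompactSupport_normed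
  have hBs : tsupport (B.normed volume) ⊆ Ioo a b := by
    rw [B.tsupport_normed_eq, Real.closedBall_eq_Icc]
    intro x hx
    change x ∈ Icc ((a + b) / 2 - (b - a) / 4) ((a + b) / 2 + (b - a) / 4) at hx
    exact ⟨by linarith [hx.1], by linarith [hx.2]⟩
  refine ⟨Λ (B.normed volume), fun φ hφ hc hs => ?_⟩
  have hfi : Integrable φ := hφ.continuous.integrable_of_hasCompactSupport hc
  have hBi : Integrable (B.normed volume) := hB.continuous.integrable_of_hasCompactSupport hBc
  set I := ∫ x, φ x with hI
  have hψs : tsupport (fun x => φ x - I * B.normed volume x) ⊆ Ioo a b :=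
    (tsupport_sub φ (fun x => I * B.normed volume x)).trans
      (union_subset hs ((tsupport_mul_subset_right (f := fun _ => I)).trans hBs))
  obtain ⟨χ, hχ, hχc, hχs, hχd⟩ := exists_deriv_eq_of_integral_eq_zero
    (θ := fun x => φ x - I * B.normed volume x) (hφ.sub (contDiff_const.mul hB))
    (hc.sub hBc.mul_left) hψs (by
      rw [integral_sub hfi (hBi.const_mul I), integral_const_mul, B.integral_normed, ← hI]
      ring)
  have := h0 χ hχ hχc hχs
  rw [hχd, hlin φ _ hφ hc hB hBc] at this
  linear_combination this

theorem integrable_smul_test {a b : ℝ} {f : ℝ → ℂ} (hf : MemLp f 2 (volume.restrict (Ioo a b)))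
    {φ : ℝ → ℝ} (hφ : ContDiff ℝ ∞ φ) (hc : HasCompactSupport φ) :
    Integrable (fun x => φ x • f x) (volume.restrict (Ioo a b)) := by
  simpa using integrable_test hf 0 hφ hc

theorem memLp_of_continuousOn_Icc {a b : ℝ} {f : ℝ → ℂ} (hf : ContinuousOn f (Icc a b)) :
    MemLp f 2 (volume.restrict (Ioo a b)) := by
  obtain ⟨M, hM⟩ := isCompact_Icc.exists_bound_of_continuousOn hf
  refine MemLp.of_bound ((hf.mono Ioo_subset_Icc_self).aestronglyMeasurable measurableSet_Ioo) M ?_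
  rw [ae_restrict_iff' measurableSet_Ioo]
  exact Eventually.of_forall fun x hx => hM x (Ioo_subset_Icc_self hx)

/-- The lemma of du Bois-Reymond. -/
theorem ae_eq_const_of_hasWeakDeriv_zero {a b : ℝ} (hab : a < b) {f : ℝ → ℂ}
    (hf : MemLp f 2 (volume.restrict (Ioo a b))) (H : HasWeakDeriv (Ioo a b) 1 f 0) :
    ∃ C : ℂ, f =ᵐ[volume.restrict (Ioo a b)] fun _ => C := by
  obtain ⟨C, hC⟩ := exists_const_of_vanishes_on_deriv hab
    (Λ := fun φ => ∫ x in Ioo a b, φ x • f x) (fun φ ψ hφ hc hψ hc' c => by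
      have := integral_sub (integrable_smul_test hf hφ hc)
        ((integrable_smul_test hf hψ hc').const_mul (c : ℂ))
      rw [integral_const_mul] at this
      rw [← this]
      refine integral_congr_ae (Eventually.of_forall fun x => ?_)
      simp only [Complex.real_smul]
      push_cast
      ring) (fun φ hφ hc hs => by
      have := H φ hφ hc hs
      rw [iteratedDeriv_one] at this
      rw [this]
      simp)
  refine ⟨C, HasWeakDeriv.unique isOpen_Ioo (n := 0) hf (memLp_const C)
    (hasWeakDeriv_zero _ f) fun φ hφ hc hs => ?_⟩
  rw [iteratedDeriv_zero, hC φ hφ hc hs, pow_zero, one_mul]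
  have hz : ∀ x, x ∉ Ioo a b → φ x • C = 0 := fun x hx => by
    rw [eq_zero_of_tsupport_subset hs hx, zero_smul]
  rw [setIntegral_eq_integral_of_forall_compl_eq_zero hz, integral_smul_const, Complex.real_smul,
    mul_comm]

theorem ae_eq_affine_of_hasWeakDeriv_zero {a b : ℝ} (hab : a < b) {f : ℝ → ℂ}
    (hf : MemLp f 2 (volume.restrict (Ioo a b))) (H : HasWeakDeriv (Ioo a b) 2 f 0) :
    ∃ C D : ℂ, f =ᵐ[volume.restrict (Ioo a b)] fun x => C + D * (x - a) := by
  obtain ⟨D, hD⟩ := exists_const_of_vanishes_on_deriv hab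
    (Λ := fun φ => ∫ x in Ioo a b, deriv φ x • f x) (fun φ ψ hφ hc hψ hc' c => by
      have := integral_sub (integrable_smul_test hf (contDiff_deriv hφ) hc.deriv)
        ((integrable_smul_test hf (contDiff_deriv hψ) hc'.deriv).const_mul (c : ℂ))
      rw [integral_const_mul] at this
      rw [← this]
      refine integral_congr_ae (Eventually.of_forall fun x => ?_)
      have hd : deriv (fun x => φ x - c * ψ x) x = deriv φ x - c * deriv ψ x := by
        have h1 := (hφ.differentiable (by simp)).differentiableAt (x := x)
        have h2 := (hψ.differentiable (by simp)).differentiableAt (x := x)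
        rw [deriv_fun_sub h1 (h2.const_mul c), deriv_const_mul c h2]
      simp only [Complex.real_smul, hd]
      push_cast
      ring) (fun φ hφ hc hs => by
      have := H φ hφ hc hs
      rw [iteratedDeriv_succ, iteratedDeriv_one] at this
      rw [this]
      simp)
  -- `D = -f'`, since `∫ φ' f = D ∫ φ`
  have hlin : HasWeakDeriv (Ioo a b) 1 (fun x => D * (x - a)) (fun _ => D) :=
    hasWeakDeriv_one_of_primitive hab.le (C := 0) intervalIntegrable_const fun x _ => by
      rw [intervalIntegral.integral_const, Complex.real_smul]
      push_cast
      ring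
  have hf1 : HasWeakDeriv (Ioo a b) 1 f (fun _ => -D) := by
    intro φ hφ hc hs
    have hz : ∀ x, x ∉ Ioo a b → φ x • (-D) = 0 := fun x hx => by
      rw [eq_zero_of_tsupport_subset hs hx, zero_smul]
    rw [iteratedDeriv_one, hD φ hφ hc hs, setIntegral_eq_integral_of_forall_compl_eq_zero hz,
      integral_smul_const, Complex.real_smul]
    ring
  have hml : MemLp (fun x : ℝ => D * (x - a)) 2 (volume.restrict (Ioo a b)) :=
    memLp_of_continuousOn_Icc (by fun_prop)
  obtain ⟨C, hC⟩ := ae_eq_const_of_hasWeakDeriv_zero hab (hf.add hml)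
    ((HasWeakDeriv.add hf hml (memLp_const (-D)) (memLp_const D) hf1 hlin).congr (ae_eq_refl _)
      (Eventually.of_forall fun x => by simp))
  refine ⟨C, -D, ?_⟩
  filter_upwards [hC] with x hx
  simp only [Pi.add_apply] at hx
  rw [← hx]
  ring

/-! ### Twofold primitives on a period -/

theorem lift_periodic (f : Torus → ℂ) (x : ℝ) : lift f (x + 2 * π) = lift f x := by
  simp only [lift, AddCircle.coe_add_period]

theorem lift_add_int_mul (f : Torus → ℂ) (n : ℤ) (x : ℝ) :
    lift f (x + n * (2 * π)) = lift f x :=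
  (show Function.Periodic (lift f) (2 * π) from lift_periodic f).int_mul n x

theorem lift_two_pi (f : Torus → ℂ) : lift f (2 * π) = lift f 0 := by
  simpa using lift_periodic f 0

theorem intervalIntegrable_lift (f : L2per) : IntervalIntegrable (lift f) volume 0 (2 * π) := by
  rw [intervalIntegrable_iff_integrableOn_Ioo_of_le Real.two_pi_pos.le]
  exact (memLp_lift f).integrable (by norm_num)

/-- The primitive of `-p` with value `β` at `0`. -/
def slope (β : ℂ) (p : ℝ → ℂ) (x : ℝ) : ℂ := β - ∫ t in 0..x, p t

/-- On the period `[0, 2π]` the function `u` is of class `C¹` with derivative `β - ∫₀ˣ p`: in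
integrated form, `u'' = -p` with `u'(0+) = β`. -/
def IsTwofoldPrimitive (u : ℝ → ℂ) (β : ℂ) (p : ℝ → ℂ) : Prop :=
  ∀ x ∈ Icc 0 (2 * π), u x = u 0 + ∫ t in 0..x, slope β p t

theorem continuousOn_slope (β : ℂ) (η : L2per) :
    ContinuousOn (slope β (lift η)) (Icc 0 (2 * π)) := by
  have h := intervalIntegral.continuousOn_primitive_interval' (intervalIntegrable_lift η)
    (left_mem_uIcc)
  rw [uIcc_of_le Real.two_pi_pos.le] at h
  exact continuousOn_const.sub h

theorem intervalIntegrable_slope (β : ℂ) (η : L2per) :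
    IntervalIntegrable (slope β (lift η)) volume 0 (2 * π) := by
  refine ContinuousOn.intervalIntegrable ?_
  rw [uIcc_of_le Real.two_pi_pos.le]
  exact continuousOn_slope β η

theorem continuousOn_integral_slope (β : ℂ) (η : L2per) :
    ContinuousOn (fun x => ∫ t in 0..x, slope β (lift η) t) (Icc 0 (2 * π)) := by
  have h := intervalIntegral.continuousOn_primitive_interval' (intervalIntegrable_slope β η)
    (left_mem_uIcc)
  rwa [uIcc_of_le Real.two_pi_pos.le] at h

theorem hasWeakDeriv_slope (β : ℂ) (η : L2per) :
    HasWeakDeriv (Ioo 0 (2 * π)) 1 (slope β (lift η)) (-lift η) :=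
  hasWeakDeriv_one_of_primitive Real.two_pi_pos.le (intervalIntegrable_lift η).neg (C := β)
    fun x _ => by
      simp only [Pi.neg_apply, intervalIntegral.integral_neg]
      rw [slope, sub_eq_add_neg]

theorem continuous_lift (u : C(Torus, ℂ)) : Continuous (lift u) :=
  u.continuous.comp (AddCircle.continuous_mk' _)

theorem IsContRep.ae_eq {u : C(Torus, ℂ)} {f : L2per} (h : IsContRep u f) :
    ⇑f =ᵐ[volume] u := by
  rw [← h]
  exact ContinuousMap.coeFn_toLp volume u

theorem IsContRep.lift_ae {u : C(Torus, ℂ)} {f : L2per} (h : IsContRep u f) (Ω : Set ℝ) :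
    lift f =ᵐ[volume.restrict Ω] lift u :=
  (PeriodicDelta.lift_ae h.ae_eq).filter_mono (ae_mono Measure.restrict_le_self)

/-- A periodic function with weak second derivative `-η` on `(0, 2π)` is a twofold primitive. -/
theorem IsNegSecondDeriv.exists_isTwofoldPrimitive {ζ η : L2per} (H : IsNegSecondDeriv ζ η)
    {u : C(Torus, ℂ)} (hu : IsContRep u ζ) : ∃ β, IsTwofoldPrimitive (lift u) β (lift η) := by
  have hW : HasWeakDeriv (Ioo 0 (2 * π)) 2 (fun x => ∫ t in 0..x, slope 0 (lift η) t)
      (-lift η) :=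
    (hasWeakDeriv_one_of_primitive Real.two_pi_pos.le (intervalIntegrable_slope 0 η) (C := 0)
      fun x _ => (zero_add _).symm).comp (hasWeakDeriv_slope 0 η)
  have hWm := memLp_of_continuousOn_Icc (continuousOn_integral_slope 0 η)
  have hd := HasWeakDeriv.add (memLp_lift ζ) (hWm.const_smul (-1 : ℂ)) (memLp_lift η).neg
    ((memLp_lift η).neg.const_smul (-1 : ℂ)) H (hW.smul (-1))
  obtain ⟨C, D, hCD⟩ := ae_eq_affine_of_hasWeakDeriv_zero Real.two_pi_pos
    ((memLp_lift ζ).add (hWm.const_smul (-1 : ℂ)))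
    (hd.congr (ae_eq_refl _) (Eventually.of_forall fun x => by simp))
  have hae : lift u =ᵐ[volume.restrict (Icc 0 (2 * π))]
      fun x => C + D * x + ∫ t in 0..x, slope 0 (lift η) t := by
    rw [← restrict_Ioo_eq_restrict_Icc]
    filter_upwards [hCD, hu.lift_ae (Ioo 0 (2 * π))] with x h1 h2
    simp only [Pi.add_apply, Pi.smul_apply, smul_eq_mul, Complex.ofReal_zero, sub_zero] at h1
    rw [← h2, ← h1]
    ring
  have heq := Measure.eqOn_Icc_of_ae_eq volume Real.two_pi_pos.ne hae
    (continuous_lift u).continuousOn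
    ((by fun_prop : Continuous fun x : ℝ => C + D * x).continuousOn.add
      (continuousOn_integral_slope 0 η))
  refine ⟨D, fun x hx => ?_⟩
  have h0 := heq (left_mem_Icc.2 Real.two_pi_pos.le)
  simp only [Complex.ofReal_zero, mul_zero, add_zero, intervalIntegral.integral_same] at h0
  have hsplit : ∫ t in 0..x, slope D (lift η) t = D * x + ∫ t in 0..x, slope 0 (lift η) t := by
    have hi : IntervalIntegrable (slope 0 (lift η)) volume 0 x :=
      (intervalIntegrable_slope 0 η).mono_set (by
        rw [uIcc_of_le hx.1, uIcc_of_le Real.two_pi_pos.le]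
        exact Icc_subset_Icc_right hx.2)
    have := intervalIntegral.integral_add (intervalIntegrable_const (c := D) (a := 0) (b := x)
      (μ := volume)) hi
    rw [intervalIntegral.integral_const, Complex.real_smul, sub_zero] at this
    rw [mul_comm D, ← this]
    refine intervalIntegral.integral_congr fun t _ => ?_
    simp only [slope]
    ring
  rw [heq hx, h0, hsplit]
  ring

theorem IsContRep.fourierCoeff_eq {u : C(Torus, ℂ)} {f : L2per} (h : IsContRep u f) (k : ℤ) :
    fourierCoeff ⇑f k = fourierCoeff ⇑u k :=
  congrFun (fourierCoeff_congr_ae (ae_haar h.ae_eq)) k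

theorem IsContRep.apply_zero {u : C(Torus, ℂ)} {f : L2per} (h : IsContRep u f)
    (hs : Summable (fourierCoeff ⇑f)) : u 0 = valueAtZero f := by
  have e : fourierCoeff ⇑f = fourierCoeff ⇑u := funext h.fourierCoeff_eq
  rw [e] at hs
  have := has_pointwise_sum_fourier_series_of_summable hs 0
  simp only [fourier_eval_zero, smul_eq_mul, mul_one] at this
  rw [valueAtZero, e]
  exact this.tsum_eq.symm

theorem isContRep_fourier (n : ℤ) : IsContRep (fourier n) (mode n) := by
  apply eq_of_fourierCoeff
  intro k
  rw [IsContRep.fourierCoeff_eq (u := fourier n) rfl, fourierCoeff_fourier, fourierCoeff_mode,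
    Pi.single_apply]

theorem two_pi_mul_fourierCoeff (f : Torus → ℂ) (k : ℤ) :
    2 * π * fourierCoeff f k = ∫ x in (0 : ℝ)..2 * π, fourier (-k) (x : Torus) * lift f x := by
  rw [fourierCoeff_eq_intervalIntegral f k 0, zero_add, Complex.real_smul]
  have hp : (2 * π : ℂ) ≠ 0 := by exact_mod_cast Real.two_pi_pos.ne'
  push_cast
  rw [← mul_assoc, mul_one_div_cancel hp, one_mul]
  rfl

/-- Integrating by parts twice in the Fourier coefficients: as a periodic distribution, a twofold
primitive `u` of `-η` satisfies `u'' = -η + m δ`, where `m = u'(0+) - u'(2π-) = ∫ η`. -/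
theorem IsTwofoldPrimitive.hasDerivJump {u : C(Torus, ℂ)} {ζ η : L2per} {β : ℂ}
    (H : IsTwofoldPrimitive (lift u) β (lift η)) (hu : IsContRep u ζ) :
    HasDerivJump ζ η (∫ t in (0 : ℝ)..2 * π, lift η t) := by
  intro k
  have hp : (2 * π : ℂ) ≠ 0 := by exact_mod_cast Real.two_pi_pos.ne'
  have h2p := Real.two_pi_pos.le
  have hd : ∀ x : ℝ, HasDerivAt (fun x : ℝ => (fourier (-k) (x : Torus) : ℂ))
      (-(Complex.I * k) * fourier (-k) (x : Torus)) x := fun x => by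
    convert hasDerivAt_fourier_neg (2 * π) k x using 1
    push_cast
    field_simp
  have hc : Continuous fun x : ℝ => -(Complex.I * k) * (fourier (-k) (x : Torus) : ℂ) :=
    continuous_const.mul (continuous_lift (fourier (-k)))
  have e0 : (fourier (-k) ((0 : ℝ) : Torus) : ℂ) = 1 := by
    rw [AddCircle.coe_zero]
    exact fourier_eval_zero _
  have e1 : (fourier (-k) ((2 * π : ℝ) : Torus) : ℂ) = 1 := by
    rw [AddCircle.coe_period]
    exact fourier_eval_zero _
  have i1 := integral_deriv_mul_primitive h2p hd hc (intervalIntegrable_slope β η) (lift u 0)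
  have i2 := integral_deriv_mul_primitive h2p hd hc (intervalIntegrable_lift η).neg β
  have c1 : ∫ x in (0 : ℝ)..2 * π, -(Complex.I * k) * fourier (-k) (x : Torus) *
      (lift u 0 + ∫ t in 0..x, slope β (lift η) t) =
      -(Complex.I * k) * ∫ x in (0 : ℝ)..2 * π, fourier (-k) (x : Torus) * lift u x := by
    rw [← intervalIntegral.integral_const_mul]
    refine intervalIntegral.integral_congr fun x hx => ?_
    rw [uIcc_of_le h2p] at hx
    simp only [H x hx]
    ring
  have c2 : ∫ x in (0 : ℝ)..2 * π, -(Complex.I * k) * fourier (-k) (x : Torus) *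
      (β + ∫ t in 0..x, (-lift η) t) =
      -(Complex.I * k) * ∫ x in (0 : ℝ)..2 * π, fourier (-k) (x : Torus) *
        slope β (lift η) x := by
    rw [← intervalIntegral.integral_const_mul]
    refine intervalIntegral.integral_congr fun x hx => ?_
    simp only [slope, Pi.neg_apply, intervalIntegral.integral_neg]
    ring
  have c3 : ∫ x in (0 : ℝ)..2 * π, fourier (-k) (x : Torus) * (-lift η) x =
      -∫ x in (0 : ℝ)..2 * π, fourier (-k) (x : Torus) * lift η x := by
    rw [← intervalIntegral.integral_neg]
    simp only [Pi.neg_apply, mul_neg]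
  rw [c1, ← H _ (right_mem_Icc.2 h2p), lift_two_pi, e0, e1] at i1
  rw [c2, c3, e0, e1] at i2
  simp only [Pi.neg_apply, intervalIntegral.integral_neg] at i2
  have fζ := two_pi_mul_fourierCoeff u k
  have fη := two_pi_mul_fourierCoeff η k
  rw [← fζ] at i1
  rw [← fη] at i2
  rw [hu.fourierCoeff_eq]
  field_simp
  linear_combination (-1 : ℂ) * i2 + (-(Complex.I * k)) * i1 -
    (k : ℂ) ^ 2 * (2 * π * fourierCoeff u k) * Complex.I_sq

theorem isContRep_add {u v : C(Torus, ℂ)} {f g : L2per} (hu : IsContRep u f)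
    (hv : IsContRep v g) : IsContRep (u + v) (f + g) := by
  rw [IsContRep, map_add, hu, hv]

theorem HasDerivJump.jump_eq {g h : L2per} {m : ℂ} (H : HasDerivJump g h m) :
    m = 2 * π * fourierCoeff ⇑h 0 := by
  have hp : (2 * π : ℂ) ≠ 0 := by exact_mod_cast Real.two_pi_pos.ne'
  rw [H 0]
  field_simp
  simp

/-- Every solution of `g'' = -h + m δ` is a twofold primitive. It differs by a constant from the
periodic twofold primitive of `-h` that vanishes at the origin, since the Fourier coefficients of
order `k ≠ 0` are determined by `h` and `m = ∫ h`. -/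
theorem HasDerivJump.exists_isTwofoldPrimitive {g h : L2per} {m : ℂ} (H : HasDerivJump g h m) :
    ∃ u : C(Torus, ℂ), ∃ β, IsContRep u g ∧ IsTwofoldPrimitive (lift u) β (lift h) ∧
      m = ∫ t in (0 : ℝ)..2 * π, lift h t := by
  have hp : (2 * π : ℂ) ≠ 0 := by exact_mod_cast Real.two_pi_pos.ne'
  have h2p := Real.two_pi_pos.le
  -- the slope at `0+` for which the twofold primitive takes equal values at `0` and `2π`
  obtain ⟨β, hβ⟩ : ∃ β, ∫ t in (0 : ℝ)..2 * π, slope β (lift h) t = 0 := by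
    refine ⟨-(∫ t in (0 : ℝ)..2 * π, slope 0 (lift h) t) / (2 * π), ?_⟩
    set D := -(∫ t in (0 : ℝ)..2 * π, slope 0 (lift h) t) / (2 * π) with hD
    have := intervalIntegral.integral_add (intervalIntegrable_const (c := D) (a := 0)
      (b := 2 * π) (μ := volume)) (intervalIntegrable_slope 0 h)
    rw [intervalIntegral.integral_const, Complex.real_smul, sub_zero] at this
    have e : ∫ t in (0 : ℝ)..2 * π, slope D (lift h) t =
        ∫ t in (0 : ℝ)..2 * π, (D + slope 0 (lift h) t) := by
      refine intervalIntegral.integral_congr fun t _ => ?_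
      simp only [slope]
      ring
    rw [e, this, hD]
    push_cast
    field_simp
    ring
  set U : ℝ → ℂ := fun x => ∫ t in 0..x, slope β (lift h) t with hU
  have hU0 : U 0 = 0 := intervalIntegral.integral_same
  let u₀ : C(Torus, ℂ) := ⟨AddCircle.liftIco (2 * π) 0 U,
    AddCircle.liftIco_zero_continuous (by rw [hU0]; exact hβ.symm)
      (continuousOn_integral_slope β h)⟩
  have hu₀ : ∀ x ∈ Icc 0 (2 * π), lift u₀ x = U x := by
    have hlt : ∀ x ∈ Ico 0 (2 * π), lift u₀ x = U x := fun x hx =>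
      AddCircle.liftIco_zero_coe_apply (f := U) hx
    intro x hx
    rcases eq_or_lt_of_le hx.2 with rfl | hx2
    · rw [lift_two_pi, hlt 0 ⟨le_rfl, Real.two_pi_pos⟩, hU0]
      exact hβ.symm
    · exact hlt x ⟨hx.1, hx2⟩
  have hu₀0 : lift u₀ 0 = 0 := by rw [hu₀ 0 ⟨le_rfl, h2p⟩, hU0]
  have hprim : IsTwofoldPrimitive (lift u₀) β (lift h) := fun x hx => by
    rw [hu₀ x hx, hu₀0, zero_add]
  obtain ⟨g₀, hg₀⟩ : ∃ g₀, IsContRep u₀ g₀ := ⟨_, rfl⟩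
  have hj := hprim.hasDerivJump hg₀
  have hm : m = ∫ t in (0 : ℝ)..2 * π, lift h t := H.jump_eq.trans hj.jump_eq.symm
  set c := fourierCoeff ⇑g 0 - fourierCoeff ⇑g₀ 0 with hc
  have hg : g = g₀ + c • mode 0 := by
    apply eq_of_fourierCoeff
    intro k
    rw [fourierCoeff_add, fourierCoeff_smul, fourierCoeff_mode]
    by_cases hk : k = 0
    · subst hk
      rw [if_pos rfl, hc]
      ring
    · rw [if_neg hk, mul_zero, add_zero]
      have hk' : (k : ℂ) ^ 2 ≠ 0 := pow_ne_zero 2 (by exact_mod_cast hk)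
      apply mul_left_cancel₀ hk'
      have e := (H k).symm.trans (hj k)
      rw [hm] at e
      exact add_right_cancel e
  refine ⟨u₀ + c • fourier 0, β, ?_, fun x hx => ?_, hm⟩
  · rw [hg]
    exact isContRep_add hg₀ (by rw [IsContRep, map_smul, isContRep_fourier 0])
  · have := hprim x hx
    simp only [lift, ContinuousMap.add_apply, ContinuousMap.smul_apply, fourier_zero] at this ⊢
    rw [this]
    ring

/-! ### One-sided derivatives at the origin -/

theorem DerivTendsto.unique {u : ℝ → ℂ} {l : Filter ℝ} [l.NeBot] {a b : ℂ}
    (ha : DerivTendsto u l a) (hb : DerivTendsto u l b) : a = b := by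
  obtain ⟨v, hv, hv'⟩ := ha
  obtain ⟨w, hw, hw'⟩ := hb
  refine tendsto_nhds_unique (hv'.congr' ?_) hw'
  filter_upwards [hv, hw] with x h1 h2
  exact h1.unique h2

theorem IsTwofoldPrimitive.hasDerivAt {u : ℝ → ℂ} {β : ℂ} {η : L2per}
    (H : IsTwofoldPrimitive u β (lift η)) {x : ℝ} (hx : x ∈ Ioo 0 (2 * π)) :
    HasDerivAt u (slope β (lift η) x) x := by
  have hc := (continuousOn_slope β η).mono Ioo_subset_Icc_self
  have hi : IntervalIntegrable (slope β (lift η)) volume 0 x :=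
    (intervalIntegrable_slope β η).mono_set (by
      rw [uIcc_of_le hx.1.le, uIcc_of_le Real.two_pi_pos.le]
      exact Icc_subset_Icc_right hx.2.le)
  have h := intervalIntegral.integral_hasDerivAt_right hi
    (hc.stronglyMeasurableAtFilter isOpen_Ioo x hx) (hc.continuousAt (isOpen_Ioo.mem_nhds hx))
  refine (h.const_add (u 0)).congr_of_eventuallyEq ?_
  filter_upwards [isOpen_Ioo.mem_nhds hx] with y hy
  exact H y (Ioo_subset_Icc_self hy)

theorem IsTwofoldPrimitive.derivTendsto_right {u : ℝ → ℂ} {β : ℂ} {η : L2per}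
    (H : IsTwofoldPrimitive u β (lift η)) : DerivTendsto u (𝓝[>] 0) β := by
  refine ⟨slope β (lift η), ?_, ?_⟩
  · filter_upwards [Ioo_mem_nhdsGT Real.two_pi_pos] with x hx using H.hasDerivAt hx
  · have h : Tendsto (slope β (lift η)) (𝓝[Ioo 0 (2 * π)] 0) (𝓝 (slope β (lift η) 0)) :=
      (continuousOn_slope β η 0 (left_mem_Icc.2 Real.two_pi_pos.le)).mono Ioo_subset_Icc_self
    rw [nhdsWithin_Ioo_eq_nhdsGT Real.two_pi_pos] at h
    simpa [slope] using h

theorem IsTwofoldPrimitive.derivTendsto_left {u : Torus → ℂ} {β : ℂ} {η : L2per}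
    (H : IsTwofoldPrimitive (lift u) β (lift η)) :
    DerivTendsto (lift u) (𝓝[<] 0) (β - ∫ t in (0 : ℝ)..2 * π, lift η t) := by
  have hlt : -(2 * π) < 0 := neg_lt_zero.2 Real.two_pi_pos
  refine ⟨fun x => slope β (lift η) (x + 2 * π), ?_, ?_⟩
  · filter_upwards [Ioo_mem_nhdsLT hlt] with x hx
    have h := H.hasDerivAt (x := x + 2 * π) ⟨by linarith [hx.1], by linarith [hx.2]⟩
    have h' := h.comp_add_const x (2 * π)
    simpa only [lift_periodic] using h'
  · have h : Tendsto (slope β (lift η)) (𝓝[Ioo 0 (2 * π)] (2 * π))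
        (𝓝 (slope β (lift η) (2 * π))) :=
      (continuousOn_slope β η _ (right_mem_Icc.2 Real.two_pi_pos.le)).mono Ioo_subset_Icc_self
    rw [nhdsWithin_Ioo_eq_nhdsLT Real.two_pi_pos] at h
    refine h.comp (tendsto_nhdsWithin_iff.2 ⟨?_, ?_⟩)
    · have : Tendsto (fun x : ℝ => x + 2 * π) (𝓝 0) (𝓝 (0 + 2 * π)) :=
        (continuous_id.add continuous_const).tendsto 0
      rw [zero_add] at this
      exact this.mono_left nhdsWithin_le_nhds
    · filter_upwards [self_mem_nhdsWithin] with x hx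
      have : x < 0 := hx
      change x + 2 * π < 2 * π
      linarith

/-! ### Sobolev regularity away from `2πℤ` -/

theorem memLp_lift_of_subset (f : L2per) {Ω : Set ℝ} {a : ℝ} (h : Ω ⊆ Ioc a (a + 2 * π)) :
    MemLp (lift f) 2 (volume.restrict Ω) :=
  ((Lp.memLp f).comp_measurePreserving (AddCircle.measurePreserving_mk (2 * π) a)).mono_measure
    (Measure.restrict_mono h le_rfl)

theorem HasWeakDeriv.lift_translate {j : ℕ} {ζ g : L2per}
    (H : HasWeakDeriv (Ioo 0 (2 * π)) j (lift ζ) (lift g)) (n : ℤ) :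
    HasWeakDeriv (Ioo (2 * n * π) (2 * (n + 1) * π)) j (lift ζ) (lift g) := by
  have := H.translate (T := n * (2 * π)) (lift_add_int_mul _ n) (lift_add_int_mul _ n)
  convert this using 2 <;> ring

theorem memSobolev_translate {m : ℕ} {ζ : L2per}
    (H : ∀ j ≤ m, ∃ g : L2per, HasWeakDeriv (Ioo 0 (2 * π)) j (lift ζ) (lift g)) (n : ℤ) :
    MemSobolev (Ioo (2 * n * π) (2 * (n + 1) * π)) m (lift ζ) := by
  have hsub : Ioo (2 * n * π) (2 * (n + 1) * π) ⊆ Ioc (2 * n * π) (2 * n * π + 2 * π) := by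
    intro x hx
    exact ⟨hx.1, by linarith [hx.2]⟩
  refine ⟨memLp_lift_of_subset ζ hsub, fun j hj => ?_⟩
  obtain ⟨g, hg⟩ := H j hj
  exact ⟨lift g, memLp_lift_of_subset g hsub, hg.lift_translate n⟩

theorem memSobolev_punctured {m : ℕ} {ζ : L2per}
    (H : ∀ j ≤ m, ∃ g : L2per, HasWeakDeriv (Ioo 0 (2 * π)) j (lift ζ) (lift g)) :
    MemSobolev (Ioo (-π) π \ {0}) m (lift ζ) := by
  have hsub : Ioo (-π) π \ {0} ⊆ Ioc (-π) (-π + 2 * π) := by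
    intro x hx
    exact ⟨hx.1.1, by linarith [hx.1.2]⟩
  refine ⟨memLp_lift_of_subset ζ hsub, fun j hj => ?_⟩
  obtain ⟨g, hg⟩ := H j hj
  refine ⟨lift g, memLp_lift_of_subset g hsub, HasWeakDeriv.union (c := 0)
    (measurableSet_Ioo.diff (measurableSet_singleton 0)) (by simp)
    (memLp_lift_of_subset ζ hsub) (memLp_lift_of_subset g hsub) ?_ ?_⟩
  · have h := hg.lift_translate (-1)
    refine h.mono measurableSet_Ioo fun x hx => ?_
    have h1 : -π < x := hx.1.1.1
    have h2 : x < 0 := hx.2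
    push_cast
    exact ⟨by linarith [Real.pi_pos], by linarith⟩
  · refine hg.mono measurableSet_Ioo fun x hx => ?_
    have h1 : x < π := hx.1.1.2
    have h2 : 0 < x := hx.2
    exact ⟨h2, by linarith [Real.pi_pos]⟩

theorem IsTwofoldPrimitive.isNegSecondDeriv {u : C(Torus, ℂ)} {ζ η : L2per} {β : ℂ}
    (H : IsTwofoldPrimitive (lift u) β (lift η)) (hu : IsContRep u ζ) :
    IsNegSecondDeriv ζ η ∧
      ∀ j ≤ 2, ∃ g : L2per, HasWeakDeriv (Ioo 0 (2 * π)) j (lift ζ) (lift g) := by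
  have h1 : HasWeakDeriv (Ioo 0 (2 * π)) 1 (lift ζ) (slope β (lift η)) :=
    (hasWeakDeriv_one_of_primitive Real.two_pi_pos.le (intervalIntegrable_slope β η)
      fun x hx => H x (Ioo_subset_Icc_self hx)).congr (hu.lift_ae _).symm (ae_eq_refl _)
  have h2 := h1.comp (hasWeakDeriv_slope β η)
  refine ⟨h2, fun j hj => ?_⟩
  interval_cases j
  · exact ⟨ζ, hasWeakDeriv_zero _ _⟩
  · obtain ⟨ν, hν⟩ := exists_lift (memLp_of_continuousOn_Icc (continuousOn_slope β η))
    exact ⟨ν, h1.congr (ae_eq_refl _) hν.symm⟩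
  · obtain ⟨ν, hν⟩ := exists_lift (memLp_lift η).neg
    exact ⟨ν, h2.congr (ae_eq_refl _) hν.symm⟩

/-! ### The graphs of the operators -/

/-- The condition of strength `γ` on the value `a` at the origin and the jump `m` of the
derivative. -/
def JumpCondition : WithTop ℝ → ℂ → ℂ → Prop
  | ⊤, a, _ => a = 0
  | (γ : ℝ), a, m => m = γ * a

theorem mem_graph_deltaLaplacian {γ : WithTop ℝ} {g h : L2per} :
    (g, h) ∈ (deltaLaplacian γ).graph ↔
      ∃ m, HasDerivJump g h m ∧ JumpCondition γ (valueAtZero g) m := by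
  rw [LinearPMap.mem_graph_iff]
  constructor
  · rintro ⟨ζ, rfl, rfl⟩
    obtain ⟨u, hu, hγ⟩ := ζ.2.2.2.2
    obtain ⟨β, hβ⟩ := (isNegSecondDeriv_deltaLaplacian ζ).exists_isTwofoldPrimitive hu
    have hj := hβ.hasDerivJump hu
    refine ⟨_, hj, ?_⟩
    rw [← hu.apply_zero hj.summable]
    match γ, hγ with
    | ⊤, hγ => exact hγ
    | (γ : ℝ), ⟨a, b, ha, hb, hab⟩ =>
      rw [ha.unique hβ.derivTendsto_right, hb.unique hβ.derivTendsto_left, sub_sub_cancel] at hab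
      exact hab
  · rintro ⟨m, hj, hγ⟩
    obtain ⟨u, β, hu, hβ, hm⟩ := hj.exists_isTwofoldPrimitive
    rw [← hu.apply_zero hj.summable] at hγ
    obtain ⟨hd, hs⟩ := hβ.isNegSecondDeriv hu
    have hint : InteractionCondition γ u := by
      match γ, hγ with
      | ⊤, hγ => exact hγ
      | (γ : ℝ), hγ =>
        refine ⟨_, _, hβ.derivTendsto_right, hβ.derivTendsto_left, ?_⟩
        rw [sub_sub_cancel, ← hm]
        exact hγ
    exact ⟨⟨g, hj.mem_Hper_one, memSobolev_punctured hs, memSobolev_translate hs, u, hu, hint⟩,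
      rfl, (isNegSecondDeriv_deltaLaplacian _).unique hd⟩

theorem hasDerivJump_zero_iff {g h : L2per} :
    HasDerivJump g h 0 ↔ ∀ k : ℤ, fourierCoeff ⇑h k = (k : ℂ) ^ 2 * fourierCoeff ⇑g k := by
  simp [HasDerivJump]

theorem HasDerivJump.mem_Hper_two {g h : L2per} (H : HasDerivJump g h 0) : g ∈ Hper 2 := by
  refine (summable_sq_fourierCoeff (h + g)).congr fun k => ?_
  have e := congrArg norm (H.one_add_sq_mul k)
  rw [zero_div, sub_zero, norm_mul, norm_one_add_sq] at e
  rw [← e]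
  ring

theorem mem_graph_periodicLaplacian {g h : L2per} :
    (g, h) ∈ periodicLaplacian.graph ↔ HasDerivJump g h 0 := by
  rw [LinearPMap.mem_graph_iff, hasDerivJump_zero_iff]
  constructor
  · rintro ⟨f, rfl, rfl⟩
    exact fourierCoeff_periodicLaplacian f
  · intro H
    refine ⟨⟨g, (hasDerivJump_zero_iff.2 H).mem_Hper_two⟩, rfl, ?_⟩
    apply eq_of_fourierCoeff
    intro k
    rw [fourierCoeff_periodicLaplacian, H k]

theorem mem_graph_restrictedLaplacian {g h : L2per} :
    (g, h) ∈ restrictedLaplacian.graph ↔ HasDerivJump g h 0 ∧ valueAtZero g = 0 := by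
  rw [LinearPMap.mem_graph_iff]
  constructor
  · rintro ⟨f, rfl, rfl⟩
    obtain ⟨⟨u, hu, hu0⟩, h2⟩ := f.2
    have e : restrictedLaplacian f = periodicLaplacian ⟨f, h2⟩ :=
      LinearPMap.domRestrict_apply rfl
    have hj : HasDerivJump f (restrictedLaplacian f) 0 := by
      rw [e]
      exact mem_graph_periodicLaplacian.1 (periodicLaplacian.mem_graph ⟨f, h2⟩)
    exact ⟨hj, by rw [← hu.apply_zero hj.summable, hu0]⟩
  · rintro ⟨hj, h0⟩
    obtain ⟨u, β, hu, -, -⟩ := hj.exists_isTwofoldPrimitive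
    obtain ⟨f, hf, hf'⟩ := (LinearPMap.mem_graph_iff _).1 (mem_graph_periodicLaplacian.2 hj)
    refine ⟨⟨g, ⟨u, hu, by rw [hu.apply_zero hj.summable, h0]⟩, hj.mem_Hper_two⟩, rfl, ?_⟩
    rw [← hf']
    exact LinearPMap.domRestrict_apply hf.symm

/-! ### Adjoints through graphs -/

section Adjoint

variable {E : Type*} [NormedAddCommGroup E] [InnerProductSpace ℂ E] [CompleteSpace E]

theorem mem_graph_adjoint_iff {T : E →ₗ.[ℂ] E} (hT : Dense (T.domain : Set E)) {g h : E} :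
    (g, h) ∈ T.adjoint.graph ↔
      ∀ f f' : E, (f, f') ∈ T.graph → inner ℂ h f = inner ℂ g f' := by
  rw [LinearPMap.mem_graph_iff]
  constructor
  · rintro ⟨y, rfl, rfl⟩ f f' hf
    obtain ⟨x, rfl, rfl⟩ := (LinearPMap.mem_graph_iff _).1 hf
    exact LinearPMap.adjoint_isFormalAdjoint hT y x
  · intro H
    have H' : ∀ x : T.domain, inner ℂ h (x : E) = inner ℂ g (T x) := fun x =>
      H _ _ (T.mem_graph x)
    exact ⟨⟨g, LinearPMap.mem_adjoint_domain_of_exists g ⟨h, H'⟩⟩, rfl,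
      LinearPMap.adjoint_apply_eq hT _ H'⟩

theorem mem_graph_iff_of_isSelfAdjoint {T : E →ₗ.[ℂ] E} (hT : IsSelfAdjoint T) {g h : E} :
    (g, h) ∈ T.graph ↔ ∀ f f' : E, (f, f') ∈ T.graph → inner ℂ h f = inner ℂ g f' := by
  rw [← mem_graph_adjoint_iff hT.dense_domain, LinearPMap.isSelfAdjoint_def.1 hT]

theorem mem_deficiencySubspace_iff {T : E →ₗ.[ℂ] E} {z : ℂ} {g : E} :
    g ∈ deficiencySubspace T z ↔ (g, z • g) ∈ T.adjoint.graph := by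
  rw [LinearPMap.mem_graph_iff, deficiencySubspace, Submodule.mem_map]
  constructor
  · rintro ⟨y, hy, rfl⟩
    exact ⟨y, rfl, sub_eq_zero.1 hy⟩
  · rintro ⟨y, rfl, hy⟩
    exact ⟨y, sub_eq_zero.2 hy, rfl⟩

end Adjoint

/-! ### The restricted Laplacian and its adjoint -/

theorem dense_restrictedLaplacian : Dense (restrictedLaplacian.domain : Set L2per) := by
  rw [Submodule.dense_iff_topologicalClosure_eq_top, Submodule.topologicalClosure_eq_top_iff,
    Submodule.eq_bot_iff]
  intro g hg
  -- a vector orthogonal to the domain solves `0 = -g + m δ`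
  obtain ⟨m, hm⟩ := (exists_hasDerivJump_iff (g := 0) (h := g)).2 fun f f' hf hf0 => by
    rw [inner_zero_left]
    exact Submodule.inner_left_of_mem_orthogonal (LinearPMap.mem_domain_of_mem_graph
      (mem_graph_restrictedLaplacian.2 ⟨hf, hf0⟩)) hg
  have hc : ∀ k, fourierCoeff ⇑g k = m / (2 * π) := fun k => by
    rw [hm k, fourierCoeff_zero, mul_zero, zero_add]
  apply eq_of_fourierCoeff
  intro k
  rw [hc, eq_zero_of_fourierCoeff_const hc, fourierCoeff_zero]

theorem mem_graph_adjoint_restrictedLaplacian {g h : L2per} :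
    (g, h) ∈ restrictedLaplacian.adjoint.graph ↔ ∃ m, HasDerivJump g h m := by
  rw [mem_graph_adjoint_iff dense_restrictedLaplacian, exists_hasDerivJump_iff]
  simp only [mem_graph_restrictedLaplacian, and_imp]

theorem deficiencyIndex_restrictedLaplacian {z : ℂ} (hz : z ^ 2 = -1) :
    deficiencyIndex restrictedLaplacian z = 1 := by
  obtain ⟨G, hG, hGj⟩ := exists_greenFunction hz
  have hspan : deficiencySubspace restrictedLaplacian z = Submodule.span ℂ {G} := by
    ext g
    rw [mem_deficiencySubspace_iff, mem_graph_adjoint_restrictedLaplacian,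
      Submodule.mem_span_singleton]
    constructor
    · rintro ⟨m, hm⟩
      refine ⟨-(m / (2 * π)), ?_⟩
      apply eq_of_fourierCoeff
      intro k
      have h1 := hG k
      have h2 := hm k
      rw [fourierCoeff_smul] at h2
      have h0 : (k : ℂ) ^ 2 - z ≠ 0 := fun h => by simp [h] at h1
      rw [fourierCoeff_smul]
      apply mul_left_cancel₀ h0
      linear_combination -(m / (2 * π)) * h1 + h2
    · rintro ⟨c, rfl⟩
      refine ⟨c * -(2 * π), ?_⟩
      rw [smul_comm]
      exact hGj.smul c
  have hG0 : G ≠ 0 := by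
    rintro rfl
    have := hG 0
    rw [fourierCoeff_zero, mul_zero] at this
    exact zero_ne_one this
  rw [deficiencyIndex, hspan, ← Module.finrank_eq_rank, finrank_span_singleton hG0,
    Nat.cast_one]

/-! ### The boundary form -/

/-- The conditions of strength `γ` are isotropic for the boundary form. -/
theorem JumpCondition.isotropic {γ : WithTop ℝ} {a m a' m' : ℂ} (h : JumpCondition γ a m)
    (h' : JumpCondition γ a' m') : starRingEnd ℂ m * a' = starRingEnd ℂ a * m' := by
  match γ, h, h' with
  | ⊤, h, h' =>
    have h : a = 0 := h
    have h' : a' = 0 := h'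
    rw [h, h', map_zero, mul_zero, zero_mul]
  | (γ : ℝ), h, h' =>
    have h : m = γ * a := h
    have h' : m' = γ * a' := h'
    rw [h, h', map_mul, Complex.conj_ofReal]
    ring

/-- The conditions of strength `γ` are maximal isotropic for the boundary form. -/
theorem jumpCondition_of_forall {γ : WithTop ℝ} {a m : ℂ}
    (H : ∀ a' m', JumpCondition γ a' m' → starRingEnd ℂ m * a' = starRingEnd ℂ a * m') :
    JumpCondition γ a m := by
  match γ, H with
  | ⊤, H =>
    have h := H 0 1 rfl
    rw [mul_zero, mul_one] at h
    exact (map_eq_zero _).1 h.symm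
  | (γ : ℝ), H =>
    have h := congrArg (starRingEnd ℂ) (H 1 γ (mul_one _).symm)
    rw [mul_one, map_mul, Complex.conj_conj, Complex.conj_conj, Complex.conj_ofReal,
      mul_comm] at h
    exact h

/-- The value at the origin and the jump of the derivative are independent: the constants have
no jump, and the resolvent kernel has one. -/
theorem exists_boundaryValues (a m : ℂ) :
    ∃ g h, HasDerivJump g h m ∧ valueAtZero g = a := by
  obtain ⟨G, -, hG⟩ := exists_greenFunction Complex.I_sq
  have hp : (2 * π : ℂ) ≠ 0 := by exact_mod_cast Real.two_pi_pos.ne'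
  set c := -(m / (2 * π)) with hc
  have h1 := hG.smul c
  have h2 := (hasDerivJump_mode 0).smul (a - c * valueAtZero G)
  refine ⟨_, _, by convert h1.add h2 using 1; rw [hc]; field_simp; ring, ?_⟩
  rw [valueAtZero_add h1.summable h2.summable, valueAtZero_smul, valueAtZero_smul,
    valueAtZero_mode]
  ring

theorem restrictedLaplacian_le_deltaLaplacian (γ : WithTop ℝ) :
    restrictedLaplacian ≤ deltaLaplacian γ := by
  apply LinearPMap.le_of_le_graph
  rintro ⟨g, h⟩ hgh
  obtain ⟨hj, h0⟩ := mem_graph_restrictedLaplacian.1 hgh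
  refine mem_graph_deltaLaplacian.2 ⟨0, hj, ?_⟩
  rw [h0]
  match γ with
  | ⊤ => exact rfl
  | (γ : ℝ) => exact (mul_zero _).symm

theorem inner_eq_of_mem_graph_deltaLaplacian {γ : WithTop ℝ} {g h f f' : L2per}
    (H : (g, h) ∈ (deltaLaplacian γ).graph) (H' : (f, f') ∈ (deltaLaplacian γ).graph) :
    inner ℂ h f = inner ℂ g f' := by
  obtain ⟨m, hj, hγ⟩ := mem_graph_deltaLaplacian.1 H
  obtain ⟨m', hj', hγ'⟩ := mem_graph_deltaLaplacian.1 H'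
  have h1 := hj.green hj'
  rw [hγ.isotropic hγ', sub_self] at h1
  exact sub_eq_zero.1 h1

theorem isFormalAdjoint_restrictedLaplacian :
    restrictedLaplacian.IsFormalAdjoint restrictedLaplacian := fun x y =>
  inner_eq_of_mem_graph_deltaLaplacian
    (LinearPMap.le_graph_of_le (restrictedLaplacian_le_deltaLaplacian ⊤)
      (restrictedLaplacian.mem_graph x))
    (LinearPMap.le_graph_of_le (restrictedLaplacian_le_deltaLaplacian ⊤)
      (restrictedLaplacian.mem_graph y))

/-- The adjoint of an extension of the restricted Laplacian is contained in the adjoint of the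
restricted Laplacian. -/
theorem exists_hasDerivJump_of_adjoint {B : L2per →ₗ.[ℂ] L2per} (hB : restrictedLaplacian ≤ B)
    {g h : L2per} (H : ∀ f f', (f, f') ∈ B.graph → inner ℂ h f = inner ℂ g f') :
    ∃ m, HasDerivJump g h m :=
  exists_hasDerivJump_iff.2 fun f f' hf hf0 => H f f'
    (LinearPMap.le_graph_of_le hB (mem_graph_restrictedLaplacian.2 ⟨hf, hf0⟩))

theorem dense_domain_of_restrictedLaplacian_le {B : L2per →ₗ.[ℂ] L2per}
    (hB : restrictedLaplacian ≤ B) : Dense (B.domain : Set L2per) :=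
  dense_restrictedLaplacian.mono hB.1

theorem isSelfAdjoint_deltaLaplacian (γ : WithTop ℝ) : IsSelfAdjoint (deltaLaplacian γ) := by
  have hle := restrictedLaplacian_le_deltaLaplacian γ
  rw [LinearPMap.isSelfAdjoint_def]
  apply LinearPMap.eq_of_eq_graph
  ext ⟨g, h⟩
  rw [mem_graph_adjoint_iff (dense_domain_of_restrictedLaplacian_le hle)]
  refine ⟨fun H => ?_, fun H f f' hf => inner_eq_of_mem_graph_deltaLaplacian H hf⟩
  obtain ⟨m, hj⟩ := exists_hasDerivJump_of_adjoint hle H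
  refine mem_graph_deltaLaplacian.2 ⟨m, hj, jumpCondition_of_forall fun a' m' hγ => ?_⟩
  obtain ⟨f, f', hf, rfl⟩ := exists_boundaryValues a' m'
  have h1 := hj.green hf
  rw [H f f' (mem_graph_deltaLaplacian.2 ⟨m', hf, hγ⟩), sub_self] at h1
  exact sub_eq_zero.1 h1.symm

/-- A self-adjoint operator has no proper symmetric extension. -/
theorem eq_deltaLaplacian_of_le {B : L2per →ₗ.[ℂ] L2per} (hB : IsSelfAdjoint B) {γ : WithTop ℝ}
    (hle : B.graph ≤ (deltaLaplacian γ).graph) : B = deltaLaplacian γ := by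
  refine LinearPMap.eq_of_eq_graph (le_antisymm hle ?_)
  rintro ⟨g, h⟩ H
  exact (mem_graph_iff_of_isSelfAdjoint hB).2 fun f f' hf =>
    inner_eq_of_mem_graph_deltaLaplacian H (hle hf)

/-- Every self-adjoint extension has the boundary values of some strength: if some element of the
domain does not vanish at the origin, isotropy of the boundary form makes the ratio of jump and
value real, and the same for all elements of the domain. -/
theorem exists_eq_deltaLaplacian {B : L2per →ₗ.[ℂ] L2per} (hle : restrictedLaplacian ≤ B)
    (hB : IsSelfAdjoint B) : ∃ γ : WithTop ℝ, B = deltaLaplacian γ := by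
  have hjump : ∀ {g h}, (g, h) ∈ B.graph → ∃ m, HasDerivJump g h m := fun H =>
    exists_hasDerivJump_of_adjoint hle ((mem_graph_iff_of_isSelfAdjoint hB).1 H)
  have hiso : ∀ {g h g' h' m m'}, (g, h) ∈ B.graph → (g', h') ∈ B.graph → HasDerivJump g h m →
      HasDerivJump g' h' m' →
      starRingEnd ℂ m * valueAtZero g' = starRingEnd ℂ (valueAtZero g) * m' := by
    intro g h g' h' m m' H H' hj hj'
    have h1 := hj.green hj'
    rw [(mem_graph_iff_of_isSelfAdjoint hB).1 H _ _ H', sub_self] at h1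
    exact sub_eq_zero.1 h1.symm
  by_cases h0 : ∀ g h, (g, h) ∈ B.graph → valueAtZero g = 0
  · refine ⟨⊤, eq_deltaLaplacian_of_le hB ?_⟩
    rintro ⟨g, h⟩ H
    obtain ⟨m, hj⟩ := hjump H
    exact mem_graph_deltaLaplacian.2 ⟨m, hj, h0 g h H⟩
  · push Not at h0
    obtain ⟨g₀, h₀, H₀, ha⟩ := h0
    obtain ⟨m₀, hj₀⟩ := hjump H₀
    have ha' : starRingEnd ℂ (valueAtZero g₀) ≠ 0 := (map_ne_zero _).2 ha
    have hreal : starRingEnd ℂ (m₀ / valueAtZero g₀) = m₀ / valueAtZero g₀ := by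
      rw [map_div₀, div_eq_div_iff ha' ha, hiso H₀ H₀ hj₀ hj₀, mul_comm]
    obtain ⟨γ, hγ⟩ := Complex.conj_eq_iff_real.1 hreal
    refine ⟨(γ : ℝ), eq_deltaLaplacian_of_le hB ?_⟩
    rintro ⟨g, h⟩ H
    obtain ⟨m, hj⟩ := hjump H
    refine mem_graph_deltaLaplacian.2 ⟨m, hj, ?_⟩
    change m = γ * valueAtZero g
    have h1 := hiso H₀ H hj₀ hj
    rw [← hγ, ← hreal, map_div₀, div_mul_eq_mul_div, h1, mul_div_cancel_left₀ _ ha']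

theorem deltaLaplacian_zero : deltaLaplacian ((0 : ℝ) : WithTop ℝ) = periodicLaplacian := by
  apply LinearPMap.eq_of_eq_graph
  ext ⟨g, h⟩
  rw [mem_graph_deltaLaplacian, mem_graph_periodicLaplacian]
  have h0 : ∀ m, JumpCondition ((0 : ℝ) : WithTop ℝ) (valueAtZero g) m ↔ m = 0 := fun m => by
    change m = ((0 : ℝ) : ℂ) * valueAtZero g ↔ m = 0
    rw [Complex.ofReal_zero, zero_mul]
  simp only [h0, exists_eq_right]

end PeriodicDelta

end

theorem theorem3p1 :
    -- the restriction of `-d²/dx²` is densely defined and symmetric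
    Dense (PeriodicDelta.restrictedLaplacian.domain : Set PeriodicDelta.L2per) ∧
    PeriodicDelta.restrictedLaplacian.IsFormalAdjoint PeriodicDelta.restrictedLaplacian ∧
    -- its deficiency indices are `(1, 1)`
    PeriodicDelta.deficiencyIndex PeriodicDelta.restrictedLaplacian Complex.I = 1 ∧
    PeriodicDelta.deficiencyIndex PeriodicDelta.restrictedLaplacian (-Complex.I) = 1 ∧
    -- its self-adjoint extensions are exactly the operators `-Δ_γ`, `γ ∈ (-∞, +∞]`
    (∀ B : PeriodicDelta.L2per →ₗ.[ℂ] PeriodicDelta.L2per,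
      (PeriodicDelta.restrictedLaplacian ≤ B ∧ IsSelfAdjoint B) ↔
        ∃ γ : WithTop ℝ, B = PeriodicDelta.deltaLaplacian γ) ∧
    -- `γ = 0` is the periodic Laplacian with domain `H²_per`
    PeriodicDelta.deltaLaplacian ((0 : ℝ) : WithTop ℝ) = PeriodicDelta.periodicLaplacian := by
  refine ⟨PeriodicDelta.dense_restrictedLaplacian,
    PeriodicDelta.isFormalAdjoint_restrictedLaplacian,
    PeriodicDelta.deficiencyIndex_restrictedLaplacian Complex.I_sq,
    PeriodicDelta.deficiencyIndex_restrictedLaplacian (by rw [neg_sq, Complex.I_sq]),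
    fun B => ⟨fun h => PeriodicDelta.exists_eq_deltaLaplacian h.1 h.2, ?_⟩,
    PeriodicDelta.deltaLaplacian_zero⟩
  rintro ⟨γ, rfl⟩
  exact ⟨PeriodicDelta.restrictedLaplacian_le_deltaLaplacian γ,
    PeriodicDelta.isSelfAdjoint_deltaLaplacian γ⟩
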